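/- **Setting.** Consider the descriptor system $E\dot x=Ax$, $y=Cx$ with $E,A\in\mathbb R^{n\times n}$, $C\in\mathbb R^{p\times n}$, and assume it is regular: $\det(cE-A)\neq 0$ for some constant $c$. Let $Q,P$ be nonsingular with $QEP=\mathrm{diag}(I_{n_1},N_2)$, $QAP=\mathrm{diag}(A_1,I_{n_2})$, $N_2$ nilpotent, $CP=[C_{\star,1},C_{\star,2}]$ (standard decomposition form). A pair $(E,A)$ is called *admissible* if it is regular, impulse-free (the nilpotent block in its standard decomposition form is zero), and every trajectory of $E\dot x=Ax$ tends to $0$ as $t\to\infty$. Assume that the system is R-observable ($(C_{\star,1},A_1)$ is observable) and I-observable ($\ker N_2\cap\mathrm{image}\,N_2\cap\ker C_{\star,2}=\{0\}$). The output is split among $N$ agents, $C=\mathrm{col}\{C_1,\dots,C_N\}$, $C_iP=[C_{\star,i1},C_{\star,i2}]$; agent $i$ measures $y_i=C_ix\in\mathbb R^{p_i}$. The agents communicate over a strongly connected directed graph; $\alpha_{ij}=1$ if there is an arc from $j$ to $i$, and $\alpha_{ij}=0$ otherwise; $\mathcal L=\mathrm{diag}(\sum_j\alpha_{ij})-[\alpha_{ij}]$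 is its Laplacian. Write $\mathrm{sym}\{M\}=M+M^\top$ and let $\bar\sigma$ be the largest singular value. For each $i$ let $T_{i1},T_{i2}$ be orthogonal matrices giving observability decompositions $$T_{i1}^\top A_1T_{i1}=\begin{bmatrix}A_{1,io}&0\\A_{1,ir}&A_{1,iu}\end{bmatrix},\quad C_{\star,i1}T_{i1}=[C_{i1o},0],\qquad T_{i2}^\top N_2T_{i2}=\begin{bmatrix}N_{2,io}&0\\N_{2,ir}&N_{2,iu}\end{bmatrix},\quad C_{\star,i2}T_{i2}=[C_{i2o},0],$$ where the sizes $v_{i1},v_{i2}$ of $A_{1,io},N_{2,io}$ are the observability indices, i.e. the ranks of the observability matrices, of $(C_{\star,i1},A_1)$ and $(C_{\star,i2},N_2)$. Put $T_i=\mathrm{diag}(T_{i1},T_{i2})$, $T=\mathrm{diag}(T_1,\dots,T_N)$, and $$\tilde E_{i,o}=\mathrm{diag}(I_{v_{i1}},N_{2,io}),\quad \tilde A_{i,o}=\mathrm{diag}(A_{1,io},I_{v_{i2}}),\quad C_{io}=[C_{i1o},C_{i2o}].$$ Let $Y_i$ ($i=1,\dots,N$) be arbitrary symmetric positive definite matrices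 of size $v_{i1}+v_{i2}$. **Theorem.** Assume $v_{i2}=n_2$ for all $i$. Then there is a vector $r$ with all $r_i>0$, $r^\top\mathcal L=0$, $\sum_ir_i=N$. For such an $r$, with $R=\mathrm{diag}(r_1,\dots,r_N)$ and $\hat{\mathcal L}=R\mathcal L+\mathcal L^\top R$, there is $\mu>0$ with $$T^\top(\hat{\mathcal L}\otimes I_n)T+\mathrm{diag}\{r_1Y_1^{0},\dots,r_NY_N^{0}\}>\mu I_{nN},\qquad(\ast)$$ where $Y_i^0$ is $Y_i$ acting on the observable coordinates of agent $i$, extended by zero to the unobservable ones. Let $\mu>0$ be any constant satisfying $(\ast)$ and suppose that: 1. $\gamma>\bar\sigma(\tilde Y_u)/\mu$, where $\tilde Y_u=\mathrm{diag}\{\tilde Y_{1,u},\dots,\tilde Y_{N,u}\}$ and $\tilde Y_{i,u}=r_i\begin{bmatrix}0&A_{1,ir}^\top\\A_{1,ir}&\mathrm{sym}\{A_{1,iu}\}\end{bmatrix}$; 2. $H_i=Q^{-1}\mathrm{col}\{T_{i1}\mathrm{col}\{H_{i1o},0\},\,T_{i2}\mathrm{col}\{H_{i2o},0\}\}$, where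 $H_{i,o}=\mathrm{col}\{H_{i1o},H_{i2o}\}$ is such that $(\tilde E_{i,o},\tilde A_{i,o}-H_{i,o}C_{io})$ is admissible; 3. $W_i=Q^{-1}T_i\tilde W_iT_i^\top Q$, where $\tilde W_i$ is the identity on the unobservable coordinates, is a matrix $\tilde W_{i,o}$ on the observable coordinates, has no cross terms between the two, and $\tilde W_{i,o}$ is a symmetric positive definite solution of $$\mathrm{sym}\{\tilde E_{i,o}^\top\tilde W_{i,o}(\tilde A_{i,o}-H_{i,o}C_{io})\}=-\gamma\,\tilde E_{i,o}^\top Y_i\tilde E_{i,o}.$$ Then every $W_i$ is invertible, and the distributed observer $$E\dot{\hat x}_i=A\hat x_i+H_i(y_i-C_i\hat x_i)+\gamma W_i^{-1}\sum_{j=1}^N\alpha_{ij}(E\hat x_j-E\hat x_i),\qquad i=1,\dots,N,$$ achieves omniscience: $\lim_{t\to\infty}\|\hat x_i(t)-x(t)\|=0$ for every $i$ and for all trajectories of the system and the observer. Moreover the dynamics of the errors $e_i=\hat x_i-x$, $$E\dot e_i=(A-H_iC_i)e_i-\gamma W_i^{-1}\sum_{j=1}^Nl_{ij}Ee_j,\qquad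 i=1,\dots,N,\quad \mathcal L=[l_{ij}],$$ are admissible. -/

import Mathlib

open Filter Topology Matrix
open scoped Kronecker

noncomputable section

/-! ### Descriptor systems `E x' = A x`, `y = C x` -/

/-- The pencil `(E, A)` is regular: `det (c E - A) ≠ 0` for some constant `c`. -/
def IsRegularPencil {ι : Type*} [Fintype ι] [DecidableEq ι] (E A : Matrix ι ι ℝ) : Prop :=
  ∃ c : ℝ, (c • E - A).det ≠ 0

/-- `x` is a trajectory of `E x' = A x` on the open half line `t > 0`. (No value at `t = 0` is
imposed, so that inconsistent initial states are not excluded.) -/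
def IsTrajectory {ι : Type*} [Fintype ι] (E A : Matrix ι ι ℝ) (x : ℝ → ι → ℝ) : Prop :=
  ∀ t : ℝ, 0 < t → DifferentiableAt ℝ x t ∧ E *ᵥ deriv x t = A *ᵥ x t

/-- A standard decomposition form of `(E, A)`: nonsingular `Q`, `P` with
`Q E P = diag (I, N₂)` and `Q A P = diag (A₁, I)`, where `N₂` is nilpotent. -/
structure StdForm {ι : Type*} [Fintype ι] [DecidableEq ι] (E A : Matrix ι ι ℝ) where
  n₁ : ℕ
  n₂ : ℕ
  Q : Matrix (Fin n₁ ⊕ Fin n₂) ι ℝ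
  Qinv : Matrix ι (Fin n₁ ⊕ Fin n₂) ℝ
  P : Matrix ι (Fin n₁ ⊕ Fin n₂) ℝ
  Pinv : Matrix (Fin n₁ ⊕ Fin n₂) ι ℝ
  A₁ : Matrix (Fin n₁) (Fin n₁) ℝ
  N₂ : Matrix (Fin n₂) (Fin n₂) ℝ
  Q_mul_Qinv : Q * Qinv = 1
  Qinv_mul_Q : Qinv * Q = 1
  P_mul_Pinv : P * Pinv = 1
  Pinv_mul_P : Pinv * P = 1
  E_eq : Q * E * P = fromBlocks 1 0 0 N₂
  A_eq : Q * A * P = fromBlocks A₁ 0 0 1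
  nilpotent : IsNilpotent N₂

/-- The slow part `C₁` of the output matrix, `C P = [C₁, C₂]`. -/
def StdForm.C₁ {ι π : Type*} [Fintype ι] [DecidableEq ι] {E A : Matrix ι ι ℝ}
    (S : StdForm E A) (C : Matrix π ι ℝ) : Matrix π (Fin S.n₁) ℝ :=
  (C * S.P).toCols₁

/-- The fast part `C₂` of the output matrix, `C P = [C₁, C₂]`. -/
def StdForm.C₂ {ι π : Type*} [Fintype ι] [DecidableEq ι] {E A : Matrix ι ι ℝ}
    (S : StdForm E A) (C : Matrix π ι ℝ) : Matrix π (Fin S.n₂) ℝ :=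
  (C * S.P).toCols₂

/-- No impulse occurs in the response: the nilpotent block of the standard decomposition form
vanishes. -/
def IsImpulseFree {ι : Type*} [Fintype ι] [DecidableEq ι] (E A : Matrix ι ι ℝ) : Prop :=
  ∃ S : StdForm E A, S.N₂ = 0

/-- `(E, A)` is admissible: regular, impulse-free, and every trajectory converges to zero. -/
def IsAdmissible {ι : Type*} [Fintype ι] [DecidableEq ι] (E A : Matrix ι ι ℝ) : Prop :=
  IsRegularPencil E A ∧ IsImpulseFree E A ∧
    ∀ x : ℝ → ι → ℝ, IsTrajectory E A x → Tendsto x atTop (𝓝 0)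

/-! ### Observability -/

/-- The observability matrix `col {C, C A, …, C A ^ (n - 1)}` of the pair `(C, A)`. -/
def obsMatrix {π : Type*} {n : ℕ} (C : Matrix π (Fin n) ℝ) (A : Matrix (Fin n) (Fin n) ℝ) :
    Matrix (Fin n × π) (Fin n) ℝ :=
  Matrix.of fun x b => (C * A ^ (x.1 : ℕ)) x.2 b

/-- The dimension of the observable part of `(C, A)`: the rank of the observability matrix. -/
def obsIndex {π : Type*} {n : ℕ} (C : Matrix π (Fin n) ℝ)
    (A : Matrix (Fin n) (Fin n) ℝ) : ℕ :=
  (obsMatrix C A).rank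

/-- The pair `(C, A)` is observable. -/
def IsObservablePair {π : Type*} {n : ℕ} (C : Matrix π (Fin n) ℝ)
    (A : Matrix (Fin n) (Fin n) ℝ) : Prop :=
  obsIndex C A = n

/-- R-observability: the slow pair `(C₁, A₁)` is observable. -/
def IsRObservable {ι π : Type*} [Fintype ι] [DecidableEq ι] {E A : Matrix ι ι ℝ}
    (S : StdForm E A) (C : Matrix π ι ℝ) : Prop :=
  IsObservablePair (S.C₁ C) S.A₁

/-- I-observability: `ker N₂ ∩ image N₂ ∩ ker C₂ = {0}`. -/
def IsIObservable {ι π : Type*} [Fintype ι] [DecidableEq ι] {E A : Matrix ι ι ℝ}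
    (S : StdForm E A) (C : Matrix π ι ℝ) : Prop :=
  LinearMap.ker S.N₂.mulVecLin ⊓ LinearMap.range S.N₂.mulVecLin ⊓
    LinearMap.ker (S.C₂ C).mulVecLin = ⊥

/-- An observability decomposition of the pair `(C, A)`: an orthogonal `T` with
`Tᵀ A T = [Ao, 0; Ar, Au]` and `C T = [Co, 0]`, where the size `v` of `Ao` is the dimension of the
observable part (so that `(Co, Ao)` is observable). -/
structure ObsDecomp {π : Type*} {n : ℕ} (C : Matrix π (Fin n) ℝ)
    (A : Matrix (Fin n) (Fin n) ℝ) where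
  v : ℕ
  u : ℕ
  T : Matrix (Fin n) (Fin v ⊕ Fin u) ℝ
  Ao : Matrix (Fin v) (Fin v) ℝ
  Ar : Matrix (Fin u) (Fin v) ℝ
  Au : Matrix (Fin u) (Fin u) ℝ
  Co : Matrix π (Fin v) ℝ
  v_eq : v = obsIndex C A
  transpose_mul : Tᵀ * T = 1
  mul_transpose : T * Tᵀ = 1
  A_eq : Tᵀ * A * T = fromBlocks Ao 0 Ar Au
  C_eq : C * T = fromCols Co 0

/-! ### The communication graph -/

/-- There is a directed path between any ordered pair of nodes. -/
def IsStronglyConnected {V : Type*} (G : Digraph V) : Prop :=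
  ∀ i j : V, Relation.ReflTransGen G.Adj i j

/-- The weight `α i j`: it is `1` if there is an arc from `j` to `i`, and `0` otherwise. -/
def adjWeight {V : Type*} (G : Digraph V) [DecidableRel G.Adj] : Matrix V V ℝ :=
  Matrix.of fun i j => if G.Adj j i then 1 else 0

/-- The Laplacian `D - 𝒜`, with `D` the diagonal matrix of the in-degrees. -/
def digraphLaplacian {V : Type*} [Fintype V] [DecidableEq V] (G : Digraph V)
    [DecidableRel G.Adj] : Matrix V V ℝ :=
  Matrix.diagonal (fun i => ∑ j, adjWeight G i j) - adjWeight G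

/-- `r` is a positive left null vector of the Laplacian, normalized so that its entries sum to the
number of nodes. -/
def IsLeftWeight {V : Type*} [Fintype V] [DecidableEq V] (G : Digraph V)
    [DecidableRel G.Adj] (r : V → ℝ) : Prop :=
  (∀ i, 0 < r i) ∧ r ᵥ* digraphLaplacian G = 0 ∧ ∑ i, r i = Fintype.card V

/-- The symmetrized Laplacian `R ℒ + ℒᵀ R`, with `R = diag r`. -/
def symLaplacian {V : Type*} [Fintype V] [DecidableEq V] (G : Digraph V)
    [DecidableRel G.Adj] (r : V → ℝ) : Matrix V V ℝ :=
  Matrix.diagonal r * digraphLaplacian G + (digraphLaplacian G)ᵀ * Matrix.diagonal r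

/-! ### The distributed observer -/

/-- The rows `C i` of the output matrix `C = col {C 1, …, C N}` that are available to agent `i`. -/
def localOutput {N : ℕ} {p : Fin N → ℕ} {ι : Type*}
    (C : Matrix (Σ i, Fin (p i)) ι ℝ) (i : Fin N) : Matrix (Fin (p i)) ι ℝ :=
  C.submatrix (fun k => ⟨i, k⟩) id

/-- The functions `xh i` solve, for `t > 0`, the equations of the distributed observer
`E (xh i)' = A (xh i) + H i (y i - C i (xh i)) + γ (W i)⁻¹ ∑ j, α i j (E (xh j) - E (xh i))`,
where `y i = C i x`. -/
def IsDistributedObserver {N n : ℕ} {p : Fin N → ℕ} (E A : Matrix (Fin n) (Fin n) ℝ)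
    (C : Matrix (Σ i, Fin (p i)) (Fin n) ℝ) (G : Digraph (Fin N)) [DecidableRel G.Adj]
    (H : ∀ i, Matrix (Fin n) (Fin (p i)) ℝ) (W : Fin N → Matrix (Fin n) (Fin n) ℝ) (γ : ℝ)
    (x : ℝ → Fin n → ℝ) (xh : Fin N → ℝ → Fin n → ℝ) : Prop :=
  ∀ i, ∀ t : ℝ, 0 < t → DifferentiableAt ℝ (xh i) t ∧
    E *ᵥ deriv (xh i) t =
      A *ᵥ xh i t + H i *ᵥ (localOutput C i *ᵥ x t - localOutput C i *ᵥ xh i t) +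
        γ • ((W i)⁻¹ *ᵥ ∑ j, adjWeight G i j • (E *ᵥ xh j t - E *ᵥ xh i t))

/-- The matrix `I ⊗ E` of the error dynamics. -/
def errorE {n : ℕ} (N : ℕ) (E : Matrix (Fin n) (Fin n) ℝ) :
    Matrix (Fin N × Fin n) (Fin N × Fin n) ℝ :=
  (1 : Matrix (Fin N) (Fin N) ℝ) ⊗ₖ E

/-- The right-hand side matrix of the error dynamics
`E (e i)' = (A - H i C i) (e i) - γ (W i)⁻¹ ∑ j, l i j E (e j)` of `e i = xh i - x`. -/
def errorA {N n : ℕ} {p : Fin N → ℕ} (E A : Matrix (Fin n) (Fin n) ℝ)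
    (C : Matrix (Σ i, Fin (p i)) (Fin n) ℝ) (G : Digraph (Fin N)) [DecidableRel G.Adj]
    (H : ∀ i, Matrix (Fin n) (Fin (p i)) ℝ) (W : Fin N → Matrix (Fin n) (Fin n) ℝ) (γ : ℝ) :
    Matrix (Fin N × Fin n) (Fin N × Fin n) ℝ :=
  Matrix.of fun a b =>
    (if a.1 = b.1 then (A - H a.1 * localOutput C a.1) a.2 b.2 else 0) -
      γ * digraphLaplacian G a.1 b.1 * ((W a.1)⁻¹ * E) a.2 b.2

/-! ### The design -/

/-- `sym M = M + Mᵀ`. -/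
def symPart {ι : Type*} (M : Matrix ι ι ℝ) : Matrix ι ι ℝ := M + Mᵀ

/-- The largest singular value: the operator norm for the Euclidean norms. -/
def maxSingularValue {ι : Type*} [Fintype ι] [DecidableEq ι] (M : Matrix ι ι ℝ) : ℝ :=
  ‖Matrix.toEuclideanCLM (𝕜 := ℝ) M‖

/-- From a matrix on the observable coordinates (slow, fast), the matrix on all coordinates (slow
observable, slow unobservable, fast observable, fast unobservable) which is `s` times the identity
on the unobservable ones and has no coupling between observable and unobservable ones. -/
def extendObs {a b c d : ℕ}
    (M : Matrix (Fin a ⊕ Fin c) (Fin a ⊕ Fin c) ℝ) (s : ℝ) :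
    Matrix ((Fin a ⊕ Fin b) ⊕ (Fin c ⊕ Fin d)) ((Fin a ⊕ Fin b) ⊕ (Fin c ⊕ Fin d)) ℝ :=
  fromBlocks (fromBlocks M.toBlocks₁₁ 0 0 (s • 1)) (fromBlocks M.toBlocks₁₂ 0 0 0)
    (fromBlocks M.toBlocks₂₁ 0 0 0) (fromBlocks M.toBlocks₂₂ 0 0 (s • 1))

section Local

/-! Data of one agent: decompositions `D₁` of its slow pair and `D₂` of its fast pair. -/

/-- `diag (T₁, T₂)`. -/
def localT {q n₁ n₂ : ℕ} {C₁ : Matrix (Fin q) (Fin n₁) ℝ} {A₁ : Matrix (Fin n₁) (Fin n₁) ℝ}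
    {C₂ : Matrix (Fin q) (Fin n₂) ℝ} {N₂ : Matrix (Fin n₂) (Fin n₂) ℝ}
    (D₁ : ObsDecomp C₁ A₁) (D₂ : ObsDecomp C₂ N₂) :
    Matrix (Fin n₁ ⊕ Fin n₂) ((Fin D₁.v ⊕ Fin D₁.u) ⊕ (Fin D₂.v ⊕ Fin D₂.u)) ℝ :=
  fromBlocks D₁.T 0 0 D₂.T

/-- The matrix `diag (I, N₂ₒ)` of the local observable subsystem. -/
def localEo {q n₁ n₂ : ℕ} {C₁ : Matrix (Fin q) (Fin n₁) ℝ} {A₁ : Matrix (Fin n₁) (Fin n₁) ℝ}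
    {C₂ : Matrix (Fin q) (Fin n₂) ℝ} {N₂ : Matrix (Fin n₂) (Fin n₂) ℝ}
    (D₁ : ObsDecomp C₁ A₁) (D₂ : ObsDecomp C₂ N₂) :
    Matrix (Fin D₁.v ⊕ Fin D₂.v) (Fin D₁.v ⊕ Fin D₂.v) ℝ :=
  fromBlocks 1 0 0 D₂.Ao

/-- The closed-loop matrix `Aₒ - Hₒ Cₒ` of the local observable subsystem, where
`Aₒ = diag (A₁ₒ, I)`, `Hₒ = col {H₁ₒ, H₂ₒ}`, `Cₒ = [C₁ₒ, C₂ₒ]`. -/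
def localAcl {q n₁ n₂ : ℕ} {C₁ : Matrix (Fin q) (Fin n₁) ℝ} {A₁ : Matrix (Fin n₁) (Fin n₁) ℝ}
    {C₂ : Matrix (Fin q) (Fin n₂) ℝ} {N₂ : Matrix (Fin n₂) (Fin n₂) ℝ}
    (D₁ : ObsDecomp C₁ A₁) (D₂ : ObsDecomp C₂ N₂)
    (H₁ : Matrix (Fin D₁.v) (Fin q) ℝ) (H₂ : Matrix (Fin D₂.v) (Fin q) ℝ) :
    Matrix (Fin D₁.v ⊕ Fin D₂.v) (Fin D₁.v ⊕ Fin D₂.v) ℝ :=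
  fromBlocks D₁.Ao 0 0 1 - fromRows H₁ H₂ * fromCols D₁.Co D₂.Co

/-- The matrix `[0, Arᵀ; Ar, sym Au]` of the slow unobservable part. -/
def localYu {q n₁ : ℕ} {C₁ : Matrix (Fin q) (Fin n₁) ℝ} {A₁ : Matrix (Fin n₁) (Fin n₁) ℝ}
    (D₁ : ObsDecomp C₁ A₁) : Matrix (Fin D₁.v ⊕ Fin D₁.u) (Fin D₁.v ⊕ Fin D₁.u) ℝ :=
  fromBlocks 0 D₁.Arᵀ D₁.Ar (symPart D₁.Au)

end Local

/-- The observer gain `Q⁻¹ col {T₁ col {H₁ₒ, 0}, T₂ col {H₂ₒ, 0}}`. -/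
def gainH {ι : Type*} [Fintype ι] [DecidableEq ι] {E A : Matrix ι ι ℝ} (S : StdForm E A) {q : ℕ}
    {C : Matrix (Fin q) ι ℝ} (D₁ : ObsDecomp (S.C₁ C) S.A₁) (D₂ : ObsDecomp (S.C₂ C) S.N₂)
    (H₁ : Matrix (Fin D₁.v) (Fin q) ℝ) (H₂ : Matrix (Fin D₂.v) (Fin q) ℝ) :
    Matrix ι (Fin q) ℝ :=
  S.Qinv * fromRows
    (D₁.T * (fromRows H₁ 0 : Matrix (Fin D₁.v ⊕ Fin D₁.u) (Fin q) ℝ))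
    (D₂.T * (fromRows H₂ 0 : Matrix (Fin D₂.v ⊕ Fin D₂.u) (Fin q) ℝ))

/-- The weight matrix `Q⁻¹ T W̃ Tᵀ Q`, where `W̃` is the given matrix `Wo` on the observable
coordinates and the identity on the unobservable ones. -/
def weightW {ι : Type*} [Fintype ι] [DecidableEq ι] {E A : Matrix ι ι ℝ} (S : StdForm E A) {q : ℕ}
    {C : Matrix (Fin q) ι ℝ} (D₁ : ObsDecomp (S.C₁ C) S.A₁) (D₂ : ObsDecomp (S.C₂ C) S.N₂)
    (Wo : Matrix (Fin D₁.v ⊕ Fin D₂.v) (Fin D₁.v ⊕ Fin D₂.v) ℝ) : Matrix ι ι ℝ :=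
  S.Qinv * (localT D₁ D₂ * extendObs (b := D₁.u) (d := D₂.u) Wo 1 * (localT D₁ D₂)ᵀ) * S.Q

/-- `Ỹᵤ`, the block diagonal matrix of the blocks `r i [0, Arᵀ; Ar, sym Au]`. -/
def globalYu {N n₁ : ℕ} {p : Fin N → ℕ} {C₁ : ∀ i, Matrix (Fin (p i)) (Fin n₁) ℝ}
    {A₁ : Matrix (Fin n₁) (Fin n₁) ℝ} (D₁ : ∀ i, ObsDecomp (C₁ i) A₁) (r : Fin N → ℝ) :
    Matrix (Σ i, Fin (D₁ i).v ⊕ Fin (D₁ i).u) (Σ i, Fin (D₁ i).v ⊕ Fin (D₁ i).u) ℝ :=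
  Matrix.blockDiagonal' fun i => r i • localYu (D₁ i)

/-- The block diagonal matrix `T = diag {T 1, …, T N}`. -/
def globalT {N n₁ n₂ : ℕ} {p : Fin N → ℕ} {C₁ : ∀ i, Matrix (Fin (p i)) (Fin n₁) ℝ}
    {A₁ : Matrix (Fin n₁) (Fin n₁) ℝ} {C₂ : ∀ i, Matrix (Fin (p i)) (Fin n₂) ℝ}
    {N₂ : Matrix (Fin n₂) (Fin n₂) ℝ}
    (D₁ : ∀ i, ObsDecomp (C₁ i) A₁) (D₂ : ∀ i, ObsDecomp (C₂ i) N₂) :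
    Matrix (Fin N × (Fin n₁ ⊕ Fin n₂))
      (Σ i, (Fin (D₁ i).v ⊕ Fin (D₁ i).u) ⊕ (Fin (D₂ i).v ⊕ Fin (D₂ i).u)) ℝ :=
  Matrix.of fun a b => if a.1 = b.1 then localT (D₁ b.1) (D₂ b.1) a.2 b.2 else 0

/-- `Tᵀ ((R ℒ + ℒᵀ R) ⊗ I) T + diag {r i Y i}  >  μ I`, where `Y i` acts on the observable
coordinates of agent `i` and is extended by zero. -/
def IsJointBound {N n₁ n₂ : ℕ} {p : Fin N → ℕ} {C₁ : ∀ i, Matrix (Fin (p i)) (Fin n₁) ℝ}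
    {A₁ : Matrix (Fin n₁) (Fin n₁) ℝ} {C₂ : ∀ i, Matrix (Fin (p i)) (Fin n₂) ℝ}
    {N₂ : Matrix (Fin n₂) (Fin n₂) ℝ}
    (D₁ : ∀ i, ObsDecomp (C₁ i) A₁) (D₂ : ∀ i, ObsDecomp (C₂ i) N₂)
    (G : Digraph (Fin N)) [DecidableRel G.Adj] (r : Fin N → ℝ)
    (Y : ∀ i, Matrix (Fin (D₁ i).v ⊕ Fin (D₂ i).v) (Fin (D₁ i).v ⊕ Fin (D₂ i).v) ℝ)
    (μ : ℝ) : Prop :=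
  ((globalT D₁ D₂)ᵀ *
        (symLaplacian G r ⊗ₖ (1 : Matrix (Fin n₁ ⊕ Fin n₂) (Fin n₁ ⊕ Fin n₂) ℝ)) *
        globalT D₁ D₂ +
      Matrix.blockDiagonal' (fun i => r i • extendObs (Y i) 0) -
      μ • 1).PosDef

end

/-! The errors are measured by `y i = T_iᵀ Q E e_i`, and the Lyapunov function is `V = ∑ r_i y_iᵀ
W̃_i y_i`. In the original coordinates its weight is `r_i Qᵀ Q W_i` applied to `E e_i`. The factor
`W_i⁻¹` in the observer cancels `W_i`, so the coupling contributes `-γ` times the Laplacian form of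
the vectors `Q E e_i = T_i y_i`, weighted by `r` (`dotProduct_lyapM_inv`).

The Lyapunov equation turns the local dynamics into `-γ r_i y_iₒᵀ Y_i y_iₒ` plus the form of
`Ỹ_{i,u}` in the slow coordinates (`local_lyapunov`). Together, the derivative of `V` is at most
`-γ` times the form in the joint bound plus `σ̄(Ỹᵤ) |y|²`, hence at most `-(γ μ - σ̄(Ỹᵤ)) |y|²`.
This gives `E e_i → 0`.

It remains to recover `e` from `E e`. Impulse-freeness is handled as the index-one condition
`IsIndexOne`, equivalent to a standard form with `N₂ = 0`. The coupling acts through `E` and so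
vanishes on the kernel of `I ⊗ E`; index one for the whole network therefore follows from index one
of each local loop. This is where full fast observability enters: no fast unobservable coordinates
are left. In a pencil of index one the state is a fixed linear function of `E x`, so `e → 0`
(`IsIndexOne.isAdmissible`).

A valid `μ` exists because the matrix in the joint bound is positive definite
(`jointMatrix_posDef`): a null vector has all `T_i z_i` equal, by strong connectivity, and no
observable coordinates, so it is a slow state unseen by every agent, which R-observability excludes.
-/

set_option linter.unusedSectionVars false

/-! ### Pencils of index one -/

section Pencil

variable {ι κ : Type*} [Fintype ι] [DecidableEq ι] [Fintype κ] [DecidableEq κ]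

/-- The pencil `(E, A)` has index at most one: `A` maps no nonzero vector of the kernel of `E` into
the range of `E`. -/
def IsIndexOne (E A : Matrix ι ι ℝ) : Prop :=
  ∀ v w : ι → ℝ, E *ᵥ v = 0 → A *ᵥ v = E *ᵥ w → v = 0

theorem exists_inverse_of_mulVec_injective {P : Matrix ι κ ℝ}
    (hP : Function.Injective P.mulVec) (hc : Fintype.card ι = Fintype.card κ) :
    ∃ P' : Matrix κ ι ℝ, P * P' = 1 ∧ P' * P = 1 := by
  obtain ⟨g, hg⟩ := LinearMap.exists_leftInverse_of_injective P.mulVecLin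
    (LinearMap.ker_eq_bot.2 hP)
  refine ⟨LinearMap.toMatrix' g, ?_⟩
  have h : LinearMap.toMatrix' g * P = 1 := by
    have := congrArg LinearMap.toMatrix' hg
    rwa [LinearMap.toMatrix'_comp, ← Matrix.toLin'_apply', LinearMap.toMatrix'_toLin',
      LinearMap.toMatrix'_id] at this
  exact ⟨(Matrix.mul_eq_one_comm_of_card_eq _ _ _ hc).2 h, h⟩

theorem StdForm.mulVec_P_Pinv {E A : Matrix ι ι ℝ} (S : StdForm E A) (v : ι → ℝ) :
    S.P *ᵥ (S.Pinv *ᵥ v) = v := by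
  rw [mulVec_mulVec, S.P_mul_Pinv, one_mulVec]

theorem StdForm.Q_mul_E {E A : Matrix ι ι ℝ} (S : StdForm E A) :
    S.Q * E = (fromBlocks 1 0 0 S.N₂ : Matrix (Fin S.n₁ ⊕ Fin S.n₂) (Fin S.n₁ ⊕ Fin S.n₂) ℝ) * S.Pinv := by
  rw [← S.E_eq, Matrix.mul_assoc (S.Q * E), S.P_mul_Pinv, Matrix.mul_one]

theorem StdForm.Q_mul_A {E A : Matrix ι ι ℝ} (S : StdForm E A) :
    S.Q * A = (fromBlocks S.A₁ 0 0 1 : Matrix (Fin S.n₁ ⊕ Fin S.n₂) (Fin S.n₁ ⊕ Fin S.n₂) ℝ) * S.Pinv := by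
  rw [← S.A_eq, Matrix.mul_assoc (S.Q * A), S.P_mul_Pinv, Matrix.mul_one]

/-- In the standard coordinates `E` keeps exactly the slow part and `A` is the identity on the fast
part: `E v = 0` kills the former, `A v ∈ range E` the latter. -/
theorem StdForm.isIndexOne {E A : Matrix ι ι ℝ} (S : StdForm E A) (hS : S.N₂ = 0) :
    IsIndexOne E A := by
  intro v w hv hw
  have h1 : S.Q *ᵥ (E *ᵥ v) = 0 := by rw [hv, mulVec_zero]
  have h2 : S.Q *ᵥ (A *ᵥ v) = S.Q *ᵥ (E *ᵥ w) := by rw [hw]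
  rw [mulVec_mulVec, S.Q_mul_E, ← mulVec_mulVec, fromBlocks_mulVec] at h1
  rw [mulVec_mulVec, mulVec_mulVec, S.Q_mul_E, S.Q_mul_A, ← mulVec_mulVec, ← mulVec_mulVec,
    fromBlocks_mulVec, fromBlocks_mulVec] at h2
  have h3 : S.Pinv *ᵥ v = 0 := by
    funext k
    rcases k with k | k
    · simpa using congrFun h1 (Sum.inl k)
    · simpa [hS] using congrFun h2 (Sum.inr k)
  rw [← S.mulVec_P_Pinv v, h3, mulVec_zero]

/-- `c E - A` becomes `diag (c I - A₁, -I)`, so any `c` outside the spectrum of `A₁` works. -/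
theorem StdForm.isRegularPencil {E A : Matrix ι ι ℝ} (S : StdForm E A) (hS : S.N₂ = 0) :
    IsRegularPencil E A := by
  obtain ⟨c, hc⟩ : ∃ c : ℝ, S.A₁.charpoly.eval c ≠ 0 := by
    by_contra! h
    exact S.A₁.charpoly_monic.ne_zero (Polynomial.funext fun c => by simpa using h c)
  refine ⟨c, ?_⟩
  rw [eval_charpoly, ← isUnit_iff_ne_zero, ← Matrix.isUnit_iff_isUnit_det,
    ← Matrix.mulVec_injective_iff_isUnit] at hc
  rw [← isUnit_iff_ne_zero, ← Matrix.isUnit_iff_isUnit_det,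
    ← Matrix.mulVec_injective_iff_isUnit]
  refine (injective_iff_map_eq_zero (Matrix.mulVecLin (c • E - A))).2 fun v hv => ?_
  have h1 : S.Q *ᵥ ((c • E - A) *ᵥ v) = 0 := by
    rw [show (c • E - A) *ᵥ v = 0 from hv, mulVec_zero]
  rw [mulVec_mulVec, Matrix.mul_sub, Matrix.mul_smul, S.Q_mul_E, S.Q_mul_A, ← Matrix.smul_mul,
    ← Matrix.sub_mul, ← mulVec_mulVec, fromBlocks_smul, sub_mulVec, fromBlocks_mulVec,
    fromBlocks_mulVec] at h1
  have h3 : S.Pinv *ᵥ v = 0 := by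
    have ha : (S.Pinv *ᵥ v) ∘ Sum.inl = 0 := by
      apply hc
      rw [mulVec_zero]
      funext k
      have := congrFun h1 (Sum.inl k)
      simpa [Matrix.scalar_apply, smul_one_eq_diagonal, sub_mulVec] using this
    funext k
    rcases k with k | k
    · exact congrFun ha k
    · simpa [hS, neg_mulVec] using congrFun h1 (Sum.inr k)
  rw [← S.mulVec_P_Pinv v, h3, mulVec_zero]

/-- The fast rows of the equation read `0 = x₂`. This is what transfers decay of `E x` to decay of
`x`. -/
theorem StdForm.trajectory_eq {E A : Matrix ι ι ℝ} (S : StdForm E A) (hS : S.N₂ = 0)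
    {x : ℝ → ι → ℝ} (hx : IsTrajectory E A x) {t : ℝ} (ht : 0 < t) :
    x t = S.P *ᵥ (S.Q *ᵥ (E *ᵥ x t)) := by
  have h1 : S.Q *ᵥ (E *ᵥ deriv x t) = S.Q *ᵥ (A *ᵥ x t) := by rw [(hx t ht).2]
  rw [mulVec_mulVec, mulVec_mulVec, S.Q_mul_E, S.Q_mul_A, ← mulVec_mulVec, ← mulVec_mulVec,
    fromBlocks_mulVec, fromBlocks_mulVec] at h1
  have h3 : S.Q *ᵥ (E *ᵥ x t) = S.Pinv *ᵥ x t := by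
    rw [mulVec_mulVec, S.Q_mul_E, ← mulVec_mulVec, fromBlocks_mulVec]
    funext k
    rcases k with k | k
    · simp
    · simpa [hS] using congrFun h1 (Sum.inr k)
  rw [h3, S.mulVec_P_Pinv]

/-- The kernel of `E` and the preimage under `A` of the range of `E` are complementary for a pencil
of index one. -/
theorem IsIndexOne.isCompl {E A : Matrix ι ι ℝ} (h : IsIndexOne E A) :
    IsCompl ((LinearMap.range E.mulVecLin).comap A.mulVecLin) (LinearMap.ker E.mulVecLin) := by
  -- The preimage of `range E` is the kernel of a map into the quotient by `range E`, so its
  -- dimension is at least the rank of `E`; rank-nullity then leaves only disjointness to check.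
  have hle : Module.finrank ℝ (ι → ℝ) ≤
      Module.finrank ℝ ((LinearMap.range E.mulVecLin).comap A.mulVecLin) +
        Module.finrank ℝ (LinearMap.ker E.mulVecLin) := by
    have h1 := LinearMap.finrank_range_add_finrank_ker
      ((LinearMap.range E.mulVecLin).mkQ ∘ₗ A.mulVecLin)
    rw [LinearMap.ker_comp, Submodule.ker_mkQ] at h1
    have h2 := Submodule.finrank_le
      (LinearMap.range ((LinearMap.range E.mulVecLin).mkQ ∘ₗ A.mulVecLin))
    have h3 := Submodule.finrank_quotient_add_finrank (LinearMap.range E.mulVecLin)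
    have h4 := LinearMap.finrank_range_add_finrank_ker E.mulVecLin
    omega
  rw [Submodule.isCompl_iff_disjoint _ _ hle, Submodule.disjoint_def]
  rintro v ⟨w, hw⟩ hv
  exact h v w (by simpa using hv) (by simpa using hw.symm)

/-- A pencil of index one has a standard decomposition form without nilpotent part. -/
theorem IsIndexOne.exists_stdForm {E A : Matrix ι ι ℝ} (h : IsIndexOne E A) :
    ∃ S : StdForm E A, S.N₂ = 0 := by
  set X := (LinearMap.range E.mulVecLin).comap A.mulVecLin with hX
  set K := LinearMap.ker E.mulVecLin with hK
  have hXK : IsCompl X K := h.isCompl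
  let b₁ := Module.finBasis ℝ X
  let b₂ := Module.finBasis ℝ K
  let n₁ := Module.finrank ℝ X
  let n₂ := Module.finrank ℝ K
  let s₁ : (Fin n₁ ⊕ Fin n₂ → ℝ) →ₗ[ℝ] (ι → ℝ) :=
    X.subtype ∘ₗ b₁.equivFun.symm.toLinearMap ∘ₗ LinearMap.funLeft ℝ ℝ Sum.inl
  let s₂ : (Fin n₁ ⊕ Fin n₂ → ℝ) →ₗ[ℝ] (ι → ℝ) :=
    K.subtype ∘ₗ b₂.equivFun.symm.toLinearMap ∘ₗ LinearMap.funLeft ℝ ℝ Sum.inr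
  have hs₁ : ∀ z, s₁ z = (b₁.equivFun.symm (z ∘ Sum.inl) : ι → ℝ) := fun z => rfl
  have hs₂ : ∀ z, s₂ z = (b₂.equivFun.symm (z ∘ Sum.inr) : ι → ℝ) := fun z => rfl
  have hs₁X : ∀ z, s₁ z ∈ X := fun z => (b₁.equivFun.symm (z ∘ Sum.inl)).2
  have hs₂K : ∀ z, s₂ z ∈ K := fun z => (b₂.equivFun.symm (z ∘ Sum.inr)).2
  have hEK : ∀ z, E *ᵥ s₂ z = 0 := fun z => by simpa [hK] using hs₂K z
  have hzero : ∀ z, s₁ z = 0 → s₂ z = 0 → z = 0 := by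
    intro z h1 h2
    rw [hs₁, Submodule.coe_eq_zero, LinearEquiv.map_eq_zero_iff] at h1
    rw [hs₂, Submodule.coe_eq_zero, LinearEquiv.map_eq_zero_iff] at h2
    funext k
    rcases k with k | k
    · exact congrFun h1 k
    · exact congrFun h2 k
  -- Since `E` kills `K`, the range of `E` is already `E X`.
  have hsurj : ∀ w, ∃ c : Fin n₁ → ℝ, E *ᵥ w = E *ᵥ s₁ (Sum.elim c 0) := by
    intro w
    obtain ⟨a, ha, k, hk, rfl⟩ := Submodule.mem_sup.1
      (hXK.sup_eq_top ▸ Submodule.mem_top : w ∈ X ⊔ K)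
    refine ⟨b₁.equivFun ⟨a, ha⟩, ?_⟩
    have hk' : E *ᵥ k = 0 := by simpa [hK] using hk
    rw [hs₁, Sum.elim_comp_inl, LinearEquiv.symm_apply_apply, mulVec_add, hk', add_zero]
  -- `φ` will be `P`, a basis adapted to `X ⊕ K`. `ψ` will be `Q⁻¹`: it sends the slow basis through
  -- `E` and the fast basis through `A`, which forces both normal forms.
  let φ := LinearMap.toMatrix' (s₁ + s₂)
  let ψ := LinearMap.toMatrix' (E.mulVecLin ∘ₗ s₁ + A.mulVecLin ∘ₗ s₂)
  have hφ : ∀ z, φ *ᵥ z = s₁ z + s₂ z := fun z => LinearMap.toMatrix'_mulVec _ _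
  have hψ : ∀ z, ψ *ᵥ z = E *ᵥ s₁ z + A *ᵥ s₂ z := fun z => LinearMap.toMatrix'_mulVec _ _
  have hcard : Fintype.card ι = Fintype.card (Fin n₁ ⊕ Fin n₂) := by
    have := Submodule.finrank_add_eq_of_isCompl hXK
    simpa [n₁, n₂] using this.symm
  have hdisj := Submodule.disjoint_def.1 hXK.disjoint
  have hφinj : Function.Injective φ.mulVec := by
    refine (injective_iff_map_eq_zero φ.mulVecLin).2 fun z hz => ?_
    rw [mulVecLin_apply, hφ] at hz
    have h1 : s₁ z = 0 := hdisj _ (hs₁X z) (by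
      rw [eq_neg_of_add_eq_zero_left hz]
      exact K.neg_mem (hs₂K z))
    exact hzero z h1 (by simpa [h1] using hz)
  have hψinj : Function.Injective ψ.mulVec := by
    refine (injective_iff_map_eq_zero ψ.mulVecLin).2 fun z hz => ?_
    rw [mulVecLin_apply, hψ] at hz
    -- `E s₁ z + A s₂ z = 0` puts `A s₂ z` in the range of `E`, so `s₂ z` lies in both `X` and `K`.
    have h2 : s₂ z = 0 := hdisj _ ⟨-s₁ z, by
      rw [map_neg, mulVecLin_apply, mulVecLin_apply, eq_neg_of_add_eq_zero_left hz, neg_neg]⟩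
      (hs₂K z)
    rw [h2, mulVec_zero, add_zero] at hz
    exact hzero z (hdisj _ (hs₁X z) (by simpa [hK] using hz)) h2
  obtain ⟨φ', hφ1, hφ2⟩ := exists_inverse_of_mulVec_injective hφinj hcard
  obtain ⟨ψ', hψ1, hψ2⟩ := exists_inverse_of_mulVec_injective hψinj hcard
  -- The inclusion of `A X` in `range E = E X` supplies the columns of `A₁`.
  have hA : ∀ j : Fin n₁, ∃ c : Fin n₁ → ℝ,
      A *ᵥ s₁ (Pi.single (Sum.inl j) 1) = E *ᵥ s₁ (Sum.elim c 0) := by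
    intro j
    obtain ⟨w, hw⟩ := hs₁X (Pi.single (Sum.inl j) 1)
    obtain ⟨c, hc⟩ := hsurj w
    exact ⟨c, by rw [← hc]; simpa using hw.symm⟩
  choose c hc using hA
  have hl : ∀ j : Fin n₁, s₂ (Pi.single (Sum.inl j) 1) = 0 := by
    intro j
    have : (Pi.single (Sum.inl j) 1 : Fin n₁ ⊕ Fin n₂ → ℝ) ∘ Sum.inr = 0 := by
      funext k; simp
    rw [hs₂, this, map_zero, Submodule.coe_zero]
  have hr : ∀ j : Fin n₂, s₁ (Pi.single (Sum.inr j) 1) = 0 := by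
    intro j
    have : (Pi.single (Sum.inr j) 1 : Fin n₁ ⊕ Fin n₂ → ℝ) ∘ Sum.inl = 0 := by
      funext k; simp
    rw [hs₁, this, map_zero, Submodule.coe_zero]
  have he : ∀ d : Fin n₁ → ℝ, s₂ (Sum.elim d 0) = 0 := by
    intro d
    rw [hs₂, Sum.elim_comp_inr, map_zero, Submodule.coe_zero]
  have hEφ : E * φ = ψ * (fromBlocks 1 0 0 0 : Matrix (Fin n₁ ⊕ Fin n₂) (Fin n₁ ⊕ Fin n₂) ℝ) := by
    refine Matrix.ext_of_mulVec_single fun j => ?_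
    rw [← mulVec_mulVec, ← mulVec_mulVec, hφ, hψ, fromBlocks_mulVec]
    rcases j with j | j
    · have h1 : (1 : Matrix (Fin n₁) (Fin n₁) ℝ) *ᵥ
          ((Pi.single (Sum.inl j) 1 : Fin n₁ ⊕ Fin n₂ → ℝ) ∘ Sum.inl) = Pi.single j 1 := by
        rw [one_mulVec]; funext k; simp [Pi.single_apply]
      have h2 : (Sum.elim (Pi.single j 1) 0 : Fin n₁ ⊕ Fin n₂ → ℝ) =
          Pi.single (Sum.inl j) 1 := by
        funext k; rcases k with k | k <;> simp [Pi.single_apply]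
      simp only [zero_mulVec, add_zero, h1, h2, hl, mulVec_zero]
    · have h1 : (Pi.single (Sum.inr j) 1 : Fin n₁ ⊕ Fin n₂ → ℝ) ∘ Sum.inl = 0 := by
        funext k; simp
      simp only [zero_mulVec, add_zero, h1, he, hr, hEK, mulVec_zero, zero_add]
      rw [hs₁, Sum.elim_comp_inl, map_zero, Submodule.coe_zero, mulVec_zero]
  have hAφ : A * φ = ψ *
      (fromBlocks (Matrix.of fun k j => c j k) 0 0 1 :
        Matrix (Fin n₁ ⊕ Fin n₂) (Fin n₁ ⊕ Fin n₂) ℝ) := by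
    refine Matrix.ext_of_mulVec_single fun j => ?_
    rw [← mulVec_mulVec, ← mulVec_mulVec, hφ, hψ, fromBlocks_mulVec]
    rcases j with j | j
    · have h1 : (Matrix.of fun k j => c j k) *ᵥ
          ((Pi.single (Sum.inl j) 1 : Fin n₁ ⊕ Fin n₂ → ℝ) ∘ Sum.inl) = c j := by
        have : (Pi.single (Sum.inl j) 1 : Fin n₁ ⊕ Fin n₂ → ℝ) ∘ Sum.inl = Pi.single j 1 := by
          funext k; simp [Pi.single_apply]
        rw [this, mulVec_single_one]; rfl
      have h2 : (Pi.single (Sum.inl j) 1 : Fin n₁ ⊕ Fin n₂ → ℝ) ∘ Sum.inr = 0 := by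
        funext k; simp
      simp only [zero_mulVec, add_zero, h1, h2, hl, he, hc, mulVec_zero]
    · have h1 : (Pi.single (Sum.inr j) 1 : Fin n₁ ⊕ Fin n₂ → ℝ) ∘ Sum.inl = 0 := by
        funext k; simp
      have h2 : (Sum.elim (0 : Fin n₁ → ℝ) ((Pi.single (Sum.inr j) 1 : Fin n₁ ⊕ Fin n₂ → ℝ) ∘ Sum.inr)) =
          (Pi.single (Sum.inr j) 1 : Fin n₁ ⊕ Fin n₂ → ℝ) := by
        funext k; rcases k with k | k <;> simp
      simp only [zero_mulVec, one_mulVec, h1, zero_add, mulVec_zero, h2, hr]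
  exact ⟨{ n₁ := n₁, n₂ := n₂, Q := ψ', Qinv := ψ, P := φ, Pinv := φ',
            A₁ := Matrix.of (fun k j => c j k), N₂ := 0,
            Q_mul_Qinv := hψ2, Qinv_mul_Q := hψ1, P_mul_Pinv := hφ1, Pinv_mul_P := hφ2,
            E_eq := by rw [Matrix.mul_assoc, hEφ, ← Matrix.mul_assoc, hψ2, Matrix.one_mul],
            A_eq := by rw [Matrix.mul_assoc, hAφ, ← Matrix.mul_assoc, hψ2, Matrix.one_mul],
            nilpotent := IsNilpotent.zero }, rfl⟩

/-! ### Quadratic forms and the Lyapunov criterion -/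

theorem dotProduct_self_nonneg' (v : ι → ℝ) : 0 ≤ v ⬝ᵥ v :=
  Finset.sum_nonneg fun i _ => mul_self_nonneg (v i)

theorem Matrix.PosDef.dotProduct_pos {M : Matrix ι ι ℝ} (hM : M.PosDef) {v : ι → ℝ} (hv : v ≠ 0) :
    0 < v ⬝ᵥ M *ᵥ v := by
  simpa using hM.dotProduct_mulVec_pos hv

theorem continuous_quadForm (M : Matrix ι ι ℝ) :
    Continuous fun v : ι → ℝ => v ⬝ᵥ M *ᵥ v := by
  simp only [dotProduct, mulVec]
  fun_prop

theorem dotProduct_smul_smul (M : Matrix ι ι ℝ) (a : ℝ) (v : ι → ℝ) :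
    (a • v) ⬝ᵥ M *ᵥ (a • v) = a ^ 2 * (v ⬝ᵥ M *ᵥ v) := by
  rw [mulVec_smul, smul_dotProduct, dotProduct_smul, smul_eq_mul, smul_eq_mul]
  ring

/-- The quotient of the two forms attains a maximum on the compact unit sphere, and homogeneity
extends the bound to all vectors. -/
theorem exists_bound_quadForm (M M' : Matrix ι ι ℝ) (hM' : M'.PosDef) :
    ∃ c : ℝ, 0 < c ∧ ∀ v : ι → ℝ, v ⬝ᵥ M *ᵥ v ≤ c * (v ⬝ᵥ M' *ᵥ v) := by
  rcases isEmpty_or_nonempty ι with hι | hι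
  · exact ⟨1, one_pos, fun v => by simp [dotProduct]⟩
  have hcomp : IsCompact (Metric.sphere (0 : ι → ℝ) 1) := isCompact_sphere 0 1
  have hne : (Metric.sphere (0 : ι → ℝ) 1).Nonempty :=
    (NormedSpace.sphere_nonempty (E := ι → ℝ)).2 zero_le_one
  have hpos : ∀ v ∈ Metric.sphere (0 : ι → ℝ) 1, 0 < v ⬝ᵥ M' *ᵥ v := by
    intro v hv
    refine hM'.dotProduct_pos fun h0 => ?_
    simp [h0] at hv
  obtain ⟨u, -, hu⟩ := hcomp.exists_isMaxOn hne
    (f := fun v => (v ⬝ᵥ M *ᵥ v) / (v ⬝ᵥ M' *ᵥ v))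
    ((continuous_quadForm M).continuousOn.div (continuous_quadForm M').continuousOn
      fun v hv => (hpos v hv).ne')
  -- The maximum may be nonpositive; comparing with `1` keeps the constant positive.
  refine ⟨max ((u ⬝ᵥ M *ᵥ u) / (u ⬝ᵥ M' *ᵥ u)) 1, lt_max_of_lt_right one_pos, fun v => ?_⟩
  rcases eq_or_ne v 0 with rfl | hv
  · simp
  have hw : ‖v‖⁻¹ • v ∈ Metric.sphere (0 : ι → ℝ) 1 := by
    simp [norm_smul, norm_ne_zero_iff.2 hv]
  have h1 := (hu hw).trans (le_max_left _ (1 : ℝ))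
  rw [div_le_iff₀ (hpos _ hw)] at h1
  have h2 : v = ‖v‖ • ‖v‖⁻¹ • v := by
    rw [smul_smul, mul_inv_cancel₀ (norm_ne_zero_iff.2 hv), one_smul]
  rw [h2, dotProduct_smul_smul M, dotProduct_smul_smul M']
  nlinarith [mul_le_mul_of_nonneg_left h1 (sq_nonneg ‖v‖)]

theorem Matrix.PosDef.exists_sub_smul_one {M : Matrix ι ι ℝ} (hM : M.PosDef) :
    ∃ μ : ℝ, 0 < μ ∧ (M - μ • 1).PosDef := by
  obtain ⟨c, hc, h⟩ := exists_bound_quadForm 1 M hM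
  -- From `|v|² ≤ c vᵀ M v`; the factor `2` makes the inequality strict.
  refine ⟨(2 * c)⁻¹, by positivity, Matrix.PosDef.of_dotProduct_mulVec_pos ?_ fun v hv => ?_⟩
  · refine hM.isHermitian.sub ?_
    simp [Matrix.IsHermitian]
  · have h1 := h v
    have h2 := hM.dotProduct_pos hv
    rw [one_mulVec] at h1
    rw [star_trivial, sub_mulVec, smul_mulVec, one_mulVec, dotProduct_sub, dotProduct_smul,
      smul_eq_mul, sub_pos, inv_mul_lt_iff₀ (by positivity)]
    nlinarith [mul_pos hc h2]

theorem hasDerivAt_mulVec (M : Matrix κ ι ℝ) {x : ℝ → ι → ℝ} {x' : ι → ℝ} {t : ℝ}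
    (hx : HasDerivAt x x' t) : HasDerivAt (fun t => M *ᵥ x t) (M *ᵥ x') t := by
  rw [hasDerivAt_pi] at hx ⊢
  intro k
  simp only [mulVec, dotProduct]
  exact HasDerivAt.fun_sum fun i _ => (hx i).const_mul _

theorem hasDerivAt_dotProduct {x y : ℝ → ι → ℝ} {x' y' : ι → ℝ} {t : ℝ}
    (hx : HasDerivAt x x' t) (hy : HasDerivAt y y' t) :
    HasDerivAt (fun t => x t ⬝ᵥ y t) (x' ⬝ᵥ y t + x t ⬝ᵥ y') t := by
  rw [hasDerivAt_pi] at hx hy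
  simp only [dotProduct, ← Finset.sum_add_distrib]
  exact HasDerivAt.fun_sum fun i _ => (hx i).mul (hy i)

theorem Matrix.PosDef.dotProduct_mulVec_comm {M : Matrix ι ι ℝ} (hM : M.PosDef) (v w : ι → ℝ) :
    v ⬝ᵥ M *ᵥ w = w ⬝ᵥ M *ᵥ v := by
  have hT : Mᵀ = M := by simpa using hM.isHermitian.eq
  rw [dotProduct_mulVec, ← mulVec_transpose, hT, dotProduct_comm]

/-- A differentiable function on `t > 0` with `V' ≤ - c V` and `0 ≤ V` tends to zero. -/
theorem tendsto_zero_of_deriv_le {V V' : ℝ → ℝ} {c : ℝ} (hc : 0 < c)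
    (hV : ∀ t, 0 < t → HasDerivAt V (V' t) t) (hle : ∀ t, 0 < t → V' t ≤ -c * V t)
    (hnn : ∀ t, 0 ≤ V t) : Tendsto V atTop (𝓝 0) := by
  have hd : ∀ t, 0 < t → HasDerivAt (fun t => Real.exp (c * t) * V t)
      (Real.exp (c * t) * (c * V t + V' t)) t := by
    intro t ht
    have h1 : HasDerivAt (fun t => Real.exp (c * t)) (Real.exp (c * t) * c) t := by
      simpa using ((hasDerivAt_id t).const_mul c).exp
    exact (h1.mul (hV t ht)).congr_deriv (by ring)
  -- `exp (c t) V` is nonincreasing on the open half line. Nothing is known at `t = 0`, so the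
  -- comparison below starts at `t = 1`.
  have hanti : AntitoneOn (fun t => Real.exp (c * t) * V t) (Set.Ioi 0) := by
    refine antitoneOn_of_deriv_nonpos (convex_Ioi 0)
      (fun t ht => (hd t ht).continuousAt.continuousWithinAt) ?_ ?_
    · rw [interior_Ioi]
      exact fun t ht => (hd t ht).differentiableAt.differentiableWithinAt
    · rw [interior_Ioi]
      intro t ht
      rw [(hd t ht).deriv]
      exact mul_nonpos_of_nonneg_of_nonpos (Real.exp_pos _).le (by linarith [hle t ht])
  have hlim : Tendsto (fun t : ℝ => (Real.exp (c * 1) * V 1) * Real.exp (-(c * t))) atTop (𝓝 0) := by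
    have : Tendsto (fun t : ℝ => Real.exp (-(c * t))) atTop (𝓝 0) :=
      Real.tendsto_exp_neg_atTop_nhds_zero.comp (tendsto_id.const_mul_atTop hc)
    simpa using this.const_mul (Real.exp (c * 1) * V 1)
  refine tendsto_of_tendsto_of_tendsto_of_le_of_le' tendsto_const_nhds hlim
    (Eventually.of_forall hnn) ?_
  filter_upwards [eventually_ge_atTop 1] with t ht
  have := hanti (Set.mem_Ioi.2 one_pos) (Set.mem_Ioi.2 (one_pos.trans_le ht)) ht
  simp only at this
  rw [Real.exp_neg, ← div_eq_mul_inv, le_div_iff₀ (Real.exp_pos _), mul_comm]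
  exact this

theorem tendsto_zero_of_dotProduct_self {x : ℝ → ι → ℝ}
    (h : Tendsto (fun t => x t ⬝ᵥ x t) atTop (𝓝 0)) : Tendsto x atTop (𝓝 0) := by
  rw [tendsto_pi_nhds]
  intro i
  have h1 : Tendsto (fun t => (x t i) ^ 2) atTop (𝓝 0) := by
    refine squeeze_zero (fun t => sq_nonneg _) (fun t => ?_) h
    rw [pow_two]
    exact Finset.single_le_sum (f := fun i => x t i * x t i)
      (fun i _ => mul_self_nonneg _) (Finset.mem_univ i)
  have h2 := h1.sqrt
  simp only [Real.sqrt_sq_eq_abs, Real.sqrt_zero] at h2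
  exact (tendsto_zero_iff_abs_tendsto_zero _).2 h2

/-- Lyapunov criterion: a pencil of index one is admissible if `(E v)ᵀ M (A v) ≤ - δ |E v|²` for
a positive definite `M` and `δ > 0`. -/
theorem IsIndexOne.isAdmissible {E A M : Matrix ι ι ℝ} (h : IsIndexOne E A) (hM : M.PosDef)
    {δ : ℝ} (hδ : 0 < δ)
    (hL : ∀ v : ι → ℝ, (E *ᵥ v) ⬝ᵥ M *ᵥ (A *ᵥ v) ≤ -δ * ((E *ᵥ v) ⬝ᵥ (E *ᵥ v))) :
    IsAdmissible E A := by
  obtain ⟨S, hS⟩ := h.exists_stdForm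
  refine ⟨S.isRegularPencil hS, ⟨S, hS⟩, fun x hx => ?_⟩
  obtain ⟨c, hc, hcM⟩ := exists_bound_quadForm M 1 Matrix.PosDef.one
  obtain ⟨d, hd, hdM⟩ := exists_bound_quadForm 1 M hM
  simp only [one_mulVec] at hcM hdM
  have hpos : ∀ v : ι → ℝ, 0 ≤ v ⬝ᵥ M *ᵥ v := fun v => by
    rcases eq_or_ne v 0 with rfl | hv
    · simp
    · exact (hM.dotProduct_pos hv).le
  have hV : Tendsto (fun t => (E *ᵥ x t) ⬝ᵥ M *ᵥ (E *ᵥ x t)) atTop (𝓝 0) := by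
    -- The derivative of `V = (E x)ᵀ M (E x)` is at most `-2 δ |E x|²`, and `V ≤ c |E x|²`.
    refine tendsto_zero_of_deriv_le (c := 2 * δ / c)
      (V' := fun t => 2 * ((E *ᵥ x t) ⬝ᵥ M *ᵥ (A *ᵥ x t))) (by positivity) (fun t ht => ?_)
      (fun t ht => ?_) fun t => hpos _
    · have h1 := hasDerivAt_mulVec E (hx t ht).1.hasDerivAt
      have h2 := hasDerivAt_dotProduct h1 (hasDerivAt_mulVec M h1)
      rw [(hx t ht).2] at h2
      convert h2 using 1
      rw [hM.dotProduct_mulVec_comm (A *ᵥ x t), two_mul]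
    · have h1 := hL (x t)
      have h2 := hcM (E *ᵥ x t)
      have h3 : 2 * δ / c * ((E *ᵥ x t) ⬝ᵥ M *ᵥ (E *ᵥ x t)) ≤
          2 * δ / c * (c * ((E *ᵥ x t) ⬝ᵥ (E *ᵥ x t))) :=
        mul_le_mul_of_nonneg_left h2 (by positivity)
      rw [← mul_assoc, div_mul_cancel₀ _ hc.ne'] at h3
      linarith
  have hE : Tendsto (fun t => E *ᵥ x t) atTop (𝓝 0) := by
    refine tendsto_zero_of_dotProduct_self (squeeze_zero (fun t => dotProduct_self_nonneg' _)
      (fun t => hdM _) ?_)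
    simpa using hV.const_mul d
  have hcont : Continuous fun v : ι → ℝ => S.P *ᵥ (S.Q *ᵥ v) := by
    simp only [mulVec_mulVec]
    exact (S.P * S.Q).mulVecLin.continuous_of_finiteDimensional
  have h4 := (hcont.tendsto 0).comp hE
  simp only [mulVec_zero] at h4
  refine h4.congr' ?_
  filter_upwards [eventually_gt_atTop 0] with t ht
  exact (S.trajectory_eq hS hx ht).symm

end Pencil

/-! ### The Laplacian of a strongly connected digraph -/

section Laplacian

variable {V : Type*} [Fintype V] [DecidableEq V] (G : Digraph V) [DecidableRel G.Adj]

theorem adjWeight_nonneg (i j : V) : 0 ≤ adjWeight G i j := by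
  simp only [adjWeight, Matrix.of_apply]
  split_ifs <;> norm_num

theorem adjWeight_pos {i j : V} (h : G.Adj j i) : 0 < adjWeight G i j := by
  simp [adjWeight, h]

theorem vecMul_digraphLaplacian (r : V → ℝ) (j : V) :
    (r ᵥ* digraphLaplacian G) j =
      r j * ∑ k, adjWeight G j k - ∑ i, r i * adjWeight G i j := by
  rw [digraphLaplacian, vecMul_sub, Pi.sub_apply, vecMul_diagonal]
  rfl

theorem digraphLaplacian_mulVec_one : digraphLaplacian G *ᵥ (fun _ => 1) = 0 := by
  funext i
  rw [digraphLaplacian, sub_mulVec, Pi.sub_apply, mulVec_diagonal]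
  simp [mulVec, dotProduct]

variable {G}

/-- A strongly connected digraph has a positive left null vector of its Laplacian. -/
theorem exists_isLeftWeight (hG : IsStronglyConnected G) : ∃ r : V → ℝ, IsLeftWeight G r := by
  rcases isEmpty_or_nonempty V with hV | hV
  · exact ⟨0, fun i => (IsEmpty.false i).elim, Subsingleton.elim _ _, by simp⟩
  -- The constant vector is a right null vector, so the determinant vanishes and some left null
  -- vector exists, of unknown signs.
  obtain ⟨w, hw0, hw⟩ := Matrix.exists_vecMul_eq_zero_iff.2
    (Matrix.exists_mulVec_eq_zero_iff.1
      ⟨_, fun h => one_ne_zero (congrFun h hV.some), digraphLaplacian_mulVec_one G⟩)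
  have hle : ∀ j, |w j| * ∑ k, adjWeight G j k ≤ ∑ i, |w i| * adjWeight G i j := by
    intro j
    have h1 := congrFun hw j
    rw [vecMul_digraphLaplacian, Pi.zero_apply, sub_eq_zero] at h1
    have hd : 0 ≤ ∑ k, adjWeight G j k := Finset.sum_nonneg fun k _ => adjWeight_nonneg G j k
    rw [← abs_of_nonneg hd, ← abs_mul, h1]
    refine (Finset.abs_sum_le_sum_abs _ _).trans (Finset.sum_le_sum fun i _ => ?_)
    rw [abs_mul, abs_of_nonneg (adjWeight_nonneg G i j)]
  -- The triangle inequality gives `≤` for each `j`, and both sides have the same sum over `j`;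
  -- hence `|w|` is again a left null vector.
  have heq : ∀ j, |w j| * ∑ k, adjWeight G j k = ∑ i, |w i| * adjWeight G i j := by
    have h2 : ∑ j, |w j| * ∑ k, adjWeight G j k = ∑ j, ∑ i, |w i| * adjWeight G i j := by
      rw [Finset.sum_comm]
      simp only [Finset.mul_sum]
    exact fun j => (Finset.sum_eq_sum_iff_of_le fun j _ => hle j).1 h2 j (Finset.mem_univ j)
  have hpos : ∀ i, 0 < |w i| := by
    by_contra! h
    obtain ⟨j, hj⟩ := h
    have hj0 : |w j| = 0 := le_antisymm hj (abs_nonneg _)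
    -- A zero entry at `b` forces every term of a nonnegative sum to vanish, so zeros spread along
    -- arcs out of `b`, and then to all nodes.
    have hall : ∀ i, Relation.ReflTransGen G.Adj j i → |w i| = 0 := by
      intro i hi
      induction hi with
      | refl => exact hj0
      | @tail b c _ hbc ih =>
        have h3 := heq b
        rw [ih, zero_mul, eq_comm, Finset.sum_eq_zero_iff_of_nonneg
          fun i _ => mul_nonneg (abs_nonneg _) (adjWeight_nonneg G i b)] at h3
        exact (mul_eq_zero.1 (h3 c (Finset.mem_univ c))).resolve_right (adjWeight_pos G hbc).ne'
    exact hw0 (funext fun i => abs_eq_zero.1 (hall i (hG j i)))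
  have hsum : 0 < ∑ i, |w i| := Finset.sum_pos (fun i _ => hpos i) Finset.univ_nonempty
  have hcard : (0 : ℝ) < Fintype.card V := by exact_mod_cast Fintype.card_pos
  refine ⟨(Fintype.card V / ∑ i, |w i|) • fun i => |w i|, fun i => ?_, ?_, ?_⟩
  · exact mul_pos (div_pos hcard hsum) (hpos i)
  · rw [smul_vecMul]
    have : (fun i => |w i|) ᵥ* digraphLaplacian G = 0 := by
      funext j
      rw [vecMul_digraphLaplacian, Pi.zero_apply, sub_eq_zero, heq]
    rw [this, smul_zero]
  · simp only [Pi.smul_apply, smul_eq_mul, ← Finset.mul_sum]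
    exact div_mul_cancel₀ _ hsum.ne'

theorem symLaplacian_apply (r : V → ℝ) (i j : V) :
    symLaplacian G r i j = r i * digraphLaplacian G i j + r j * digraphLaplacian G j i := by
  rw [symLaplacian, Matrix.add_apply, diagonal_mul, mul_diagonal, transpose_apply, mul_comm (r j)]

theorem symLaplacian_transpose (r : V → ℝ) : (symLaplacian G r)ᵀ = symLaplacian G r := by
  ext i j
  rw [transpose_apply, symLaplacian_apply, symLaplacian_apply, add_comm]

/-- The quadratic form of the symmetrized Laplacian, on vectors with values in `κ → ℝ`. -/
theorem sum_symLaplacian {κ : Type*} [Fintype κ] (r : V → ℝ) (w : V → κ → ℝ) :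
    ∑ i, ∑ j, symLaplacian G r i j * (w i ⬝ᵥ w j) =
      2 * ∑ i, r i * ∑ j, digraphLaplacian G i j * (w i ⬝ᵥ w j) := by
  have h : ∑ i, ∑ j, r j * digraphLaplacian G j i * (w i ⬝ᵥ w j) =
      ∑ i, ∑ j, r i * digraphLaplacian G i j * (w i ⬝ᵥ w j) := by
    rw [Finset.sum_comm]
    exact Finset.sum_congr rfl fun i _ => Finset.sum_congr rfl fun j _ => by
      rw [dotProduct_comm]
  simp only [symLaplacian_apply, add_mul, Finset.sum_add_distrib, h, Finset.mul_sum, two_mul]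
  simp only [mul_assoc]

/-- A left null vector balances the weights `r i * α i j`: total weight into a node equals total
weight out of it. The diagonal terms can thus be shared between the two ends of each arc, completing
the squares. -/
theorem sum_symLaplacian_eq_sq {κ : Type*} [Fintype κ] {r : V → ℝ} (hr : IsLeftWeight G r)
    (w : V → κ → ℝ) :
    ∑ i, ∑ j, symLaplacian G r i j * (w i ⬝ᵥ w j) =
      ∑ i, ∑ j, r i * adjWeight G i j * ((w i - w j) ⬝ᵥ (w i - w j)) := by
  have h1 : ∀ i, ∑ j, digraphLaplacian G i j * (w i ⬝ᵥ w j) =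
      (∑ j, adjWeight G i j) * (w i ⬝ᵥ w i) - ∑ j, adjWeight G i j * (w i ⬝ᵥ w j) := by
    intro i
    simp only [digraphLaplacian, Matrix.sub_apply, sub_mul, Finset.sum_sub_distrib,
      Matrix.diagonal_apply, ite_mul, zero_mul]
    simp
  have h2 : ∀ j, ∑ i, r i * adjWeight G i j = r j * ∑ k, adjWeight G j k := by
    intro j
    have := congrFun hr.2.1 j
    rw [vecMul_digraphLaplacian, Pi.zero_apply, sub_eq_zero] at this
    exact this.symm
  have h3 : ∑ i, ∑ j, r i * adjWeight G i j * (w j ⬝ᵥ w j) =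
      ∑ i, ∑ j, r i * adjWeight G i j * (w i ⬝ᵥ w i) := by
    rw [Finset.sum_comm]
    refine Finset.sum_congr rfl fun j _ => ?_
    rw [← Finset.sum_mul, h2, ← Finset.sum_mul, Finset.mul_sum]
  have h4 : ∀ i j, (w i - w j) ⬝ᵥ (w i - w j) =
      w i ⬝ᵥ w i + w j ⬝ᵥ w j - 2 * (w i ⬝ᵥ w j) := by
    intro i j
    rw [sub_dotProduct, dotProduct_sub, dotProduct_sub, dotProduct_comm (w j) (w i)]
    ring
  rw [sum_symLaplacian]
  simp only [h1, h4, mul_sub, mul_add, Finset.sum_sub_distrib, Finset.sum_add_distrib, h3,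
    Finset.sum_mul, Finset.mul_sum]
  rw [← two_mul, Finset.mul_sum]
  congr 1
  · simp only [Finset.mul_sum, mul_assoc]
  · refine Finset.sum_congr rfl fun i _ => Finset.sum_congr rfl fun j _ => by ring

theorem sum_symLaplacian_nonneg {κ : Type*} [Fintype κ] {r : V → ℝ} (hr : IsLeftWeight G r)
    (w : V → κ → ℝ) : 0 ≤ ∑ i, ∑ j, symLaplacian G r i j * (w i ⬝ᵥ w j) := by
  classical
  rw [sum_symLaplacian_eq_sq hr]
  exact Finset.sum_nonneg fun i _ => Finset.sum_nonneg fun j _ =>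
    mul_nonneg (mul_nonneg (hr.1 i).le (adjWeight_nonneg G i j)) (dotProduct_self_nonneg' _)

theorem eq_of_sum_symLaplacian_eq_zero {κ : Type*} [Fintype κ] (hG : IsStronglyConnected G)
    {r : V → ℝ} (hr : IsLeftWeight G r) {w : V → κ → ℝ}
    (h : ∑ i, ∑ j, symLaplacian G r i j * (w i ⬝ᵥ w j) = 0) (i j : V) : w i = w j := by
  classical
  have hnn : ∀ i j, 0 ≤ r i * adjWeight G i j * ((w i - w j) ⬝ᵥ (w i - w j)) := fun i j =>
    mul_nonneg (mul_nonneg (hr.1 i).le (adjWeight_nonneg G i j)) (dotProduct_self_nonneg' _)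
  rw [sum_symLaplacian_eq_sq hr, Finset.sum_eq_zero_iff_of_nonneg
    fun i _ => Finset.sum_nonneg fun j _ => hnn i j] at h
  have hadj : ∀ a b, G.Adj a b → w a = w b := by
    intro a b hab
    have h1 := h b (Finset.mem_univ b)
    rw [Finset.sum_eq_zero_iff_of_nonneg fun j _ => hnn b j] at h1
    have h2 := (mul_eq_zero.1 (h1 a (Finset.mem_univ a))).resolve_left
      (mul_pos (hr.1 b) (adjWeight_pos G hab)).ne'
    exact (sub_eq_zero.1 (dotProduct_self_eq_zero.1 h2)).symm
  have := hG i j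
  induction this with
  | refl => rfl
  | tail _ hbc ih => exact ih.trans (hadj _ _ hbc)

end Laplacian

/-! ### Observability decompositions -/

section Observability

variable {π : Type*} {n : ℕ} {C : Matrix π (Fin n) ℝ} {A : Matrix (Fin n) (Fin n) ℝ}

theorem IsObservablePair.eq_zero (h : IsObservablePair C A) {v : Fin n → ℝ}
    (hv : ∀ k : ℕ, C *ᵥ (A ^ k *ᵥ v) = 0) : v = 0 := by
  have h1 := LinearMap.finrank_range_add_finrank_ker (obsMatrix C A).mulVecLin
  have h2 : Module.finrank ℝ (LinearMap.range (obsMatrix C A).mulVecLin) = n := h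
  rw [h2, Module.finrank_fin_fun, Nat.add_eq_left, Submodule.finrank_eq_zero] at h1
  have h3 : v ∈ LinearMap.ker (obsMatrix C A).mulVecLin := by
    rw [LinearMap.mem_ker, mulVecLin_apply]
    funext x
    have := congrFun (hv x.1) x.2
    rw [mulVec_mulVec] at this
    exact this
  rwa [h1, Submodule.mem_bot] at h3

theorem ObsDecomp.add_eq (D : ObsDecomp C A) : D.v + D.u = n := by
  have := Matrix.square_of_invertible D.T D.Tᵀ D.mul_transpose D.transpose_mul
  simpa using this.symm

theorem ObsDecomp.mul_T (D : ObsDecomp C A) :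
    A * D.T = D.T * fromBlocks D.Ao 0 D.Ar D.Au := by
  rw [← D.A_eq, ← Matrix.mul_assoc, ← Matrix.mul_assoc, D.mul_transpose, Matrix.one_mul]

/-- The subspace of the last coordinates of an observability decomposition is unobservable. -/
theorem ObsDecomp.unobservable (D : ObsDecomp C A) (b : Fin D.u → ℝ) (k : ℕ) :
    C *ᵥ (A ^ k *ᵥ (D.T *ᵥ Sum.elim 0 b)) = 0 := by
  have h : A ^ k *ᵥ (D.T *ᵥ Sum.elim 0 b) = D.T *ᵥ Sum.elim 0 (D.Au ^ k *ᵥ b) := by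
    induction k with
    | zero => simp
    | succ k ih =>
      rw [pow_succ', ← mulVec_mulVec, ih, mulVec_mulVec, D.mul_T, ← mulVec_mulVec,
        fromBlocks_mulVec, pow_succ', ← mulVec_mulVec]
      simp
  rw [h, mulVec_mulVec, D.C_eq, fromCols_mulVec]
  simp

end Observability

/-! ### Observable coordinates -/

section Coordinates

variable {α β γ δ : Type*}

/-- The observable coordinates of a vector of slow and fast coordinates. -/
def obsPart (y : (α ⊕ β) ⊕ (γ ⊕ δ) → ℝ) : α ⊕ γ → ℝ := y ∘ Sum.map Sum.inl Sum.inl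

@[simp] theorem obsPart_inl (y : (α ⊕ β) ⊕ (γ ⊕ δ) → ℝ) (k : α) :
    obsPart y (Sum.inl k) = y (Sum.inl (Sum.inl k)) := rfl

@[simp] theorem obsPart_inr (y : (α ⊕ β) ⊕ (γ ⊕ δ) → ℝ) (k : γ) :
    obsPart y (Sum.inr k) = y (Sum.inr (Sum.inl k)) := rfl

/-- Used with `s = 1` for the weights `W̃_i` and with `s = 0` for `Y_i⁰`. -/
theorem dotProduct_extendObs_mulVec {a b c d : ℕ} (M : Matrix (Fin a ⊕ Fin c) (Fin a ⊕ Fin c) ℝ)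
    (s : ℝ) (y z : (Fin a ⊕ Fin b) ⊕ (Fin c ⊕ Fin d) → ℝ) :
    y ⬝ᵥ extendObs M s *ᵥ z = obsPart y ⬝ᵥ M *ᵥ obsPart z +
      s * (∑ k, y (Sum.inl (Sum.inr k)) * z (Sum.inl (Sum.inr k)) +
        ∑ k, y (Sum.inr (Sum.inr k)) * z (Sum.inr (Sum.inr k))) := by
  have h1 : ∀ k, (extendObs (b := b) (d := d) M s *ᵥ z) (Sum.inl (Sum.inl k)) =
      (M *ᵥ obsPart z) (Sum.inl k) := by
    intro k
    simp [extendObs, mulVec, dotProduct, toBlocks₁₁, toBlocks₁₂]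
  have h2 : ∀ k, (extendObs (b := b) (d := d) M s *ᵥ z) (Sum.inl (Sum.inr k)) =
      s * z (Sum.inl (Sum.inr k)) := by
    intro k
    simp [extendObs, mulVec, dotProduct, Matrix.one_apply]
  have h3 : ∀ k, (extendObs (b := b) (d := d) M s *ᵥ z) (Sum.inr (Sum.inl k)) =
      (M *ᵥ obsPart z) (Sum.inr k) := by
    intro k
    simp [extendObs, mulVec, dotProduct, toBlocks₂₁, toBlocks₂₂]
  have h4 : ∀ k, (extendObs (b := b) (d := d) M s *ᵥ z) (Sum.inr (Sum.inr k)) =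
      s * z (Sum.inr (Sum.inr k)) := by
    intro k
    simp [extendObs, mulVec, dotProduct, Matrix.one_apply]
  rw [dotProduct, dotProduct]
  simp only [Fintype.sum_sum_type, h1, h2, h3, h4, obsPart_inl, obsPart_inr, mul_add,
    Finset.mul_sum]
  simp only [mul_left_comm s]
  ring

theorem extendObs_transpose {a b c d : ℕ} (M : Matrix (Fin a ⊕ Fin c) (Fin a ⊕ Fin c) ℝ) (s : ℝ) :
    (extendObs (b := b) (d := d) M s)ᵀ = extendObs Mᵀ s := by
  simp only [extendObs, fromBlocks_transpose, transpose_zero, transpose_smul, transpose_one]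
  rfl

theorem Matrix.PosDef.transpose_eq {κ : Type*} {M : Matrix κ κ ℝ} (hM : M.PosDef) : Mᵀ = M := by
  simpa using hM.isHermitian.eq

theorem extendObs_one_posDef {a b c d : ℕ} {M : Matrix (Fin a ⊕ Fin c) (Fin a ⊕ Fin c) ℝ}
    (hM : M.PosDef) : (extendObs (b := b) (d := d) M 1).PosDef := by
  refine Matrix.PosDef.of_dotProduct_mulVec_pos ?_ fun z hz => ?_
  · rw [Matrix.IsHermitian, conjTranspose_eq_transpose_of_trivial, extendObs_transpose,
      hM.transpose_eq]
  · rw [star_trivial, dotProduct_extendObs_mulVec, one_mul]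
    have h1 : 0 ≤ ∑ k, z (Sum.inl (Sum.inr k)) * z (Sum.inl (Sum.inr k)) :=
      Finset.sum_nonneg fun k _ => mul_self_nonneg _
    have h2 : 0 ≤ ∑ k, z (Sum.inr (Sum.inr k)) * z (Sum.inr (Sum.inr k)) :=
      Finset.sum_nonneg fun k _ => mul_self_nonneg _
    rcases eq_or_ne (obsPart z) 0 with h0 | h0
    · rw [h0, zero_dotProduct, zero_add]
      refine lt_of_le_of_ne (add_nonneg h1 h2) fun h => hz ?_
      rw [eq_comm, add_eq_zero_iff_of_nonneg h1 h2,
        Finset.sum_eq_zero_iff_of_nonneg fun k _ => mul_self_nonneg _,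
        Finset.sum_eq_zero_iff_of_nonneg fun k _ => mul_self_nonneg _] at h
      funext k
      rcases k with (k | k) | (k | k)
      · exact congrFun h0 (Sum.inl k)
      · exact mul_self_eq_zero.1 (h.1 k (Finset.mem_univ k))
      · exact congrFun h0 (Sum.inr k)
      · exact mul_self_eq_zero.1 (h.2 k (Finset.mem_univ k))
    · have := hM.dotProduct_pos h0
      linarith

end Coordinates

/-! ### Orthogonality of the local coordinate change -/

section LocalTransformation

variable {q n₁ n₂ : ℕ} {C₁ : Matrix (Fin q) (Fin n₁) ℝ} {A₁ : Matrix (Fin n₁) (Fin n₁) ℝ}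
  {C₂ : Matrix (Fin q) (Fin n₂) ℝ} {N₂ : Matrix (Fin n₂) (Fin n₂) ℝ}
  (D₁ : ObsDecomp C₁ A₁) (D₂ : ObsDecomp C₂ N₂)

theorem localT_mul_transpose : localT D₁ D₂ * (localT D₁ D₂)ᵀ = 1 := by
  rw [localT, fromBlocks_transpose, fromBlocks_multiply]
  simp [D₁.mul_transpose, D₂.mul_transpose]

theorem localT_transpose_mul : (localT D₁ D₂)ᵀ * localT D₁ D₂ = 1 := by
  rw [localT, fromBlocks_transpose, fromBlocks_multiply]
  simp [D₁.transpose_mul, D₂.transpose_mul]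

theorem localT_mulVec_eq_zero {z : (Fin D₁.v ⊕ Fin D₁.u) ⊕ (Fin D₂.v ⊕ Fin D₂.u) → ℝ}
    (hz : localT D₁ D₂ *ᵥ z = 0) : z = 0 := by
  rw [← one_mulVec z, ← localT_transpose_mul, ← mulVec_mulVec, hz, mulVec_zero]

theorem dotProduct_localT_mulVec
    (y z : (Fin D₁.v ⊕ Fin D₁.u) ⊕ (Fin D₂.v ⊕ Fin D₂.u) → ℝ) :
    (localT D₁ D₂ *ᵥ y) ⬝ᵥ (localT D₁ D₂ *ᵥ z) = y ⬝ᵥ z := by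
  rw [dotProduct_mulVec, ← mulVec_transpose, mulVec_mulVec, localT_transpose_mul, one_mulVec]

end LocalTransformation

/-! ### The joint bound -/

section Joint

variable {N n₁ n₂ : ℕ} {p : Fin N → ℕ} {C₁ : ∀ i, Matrix (Fin (p i)) (Fin n₁) ℝ}
  {A₁ : Matrix (Fin n₁) (Fin n₁) ℝ} {C₂ : ∀ i, Matrix (Fin (p i)) (Fin n₂) ℝ}
  {N₂ : Matrix (Fin n₂) (Fin n₂) ℝ}
  (D₁ : ∀ i, ObsDecomp (C₁ i) A₁) (D₂ : ∀ i, ObsDecomp (C₂ i) N₂)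
  (G : Digraph (Fin N)) [DecidableRel G.Adj] (r : Fin N → ℝ)
  (Y : ∀ i, Matrix (Fin (D₁ i).v ⊕ Fin (D₂ i).v) (Fin (D₁ i).v ⊕ Fin (D₂ i).v) ℝ)

/-- The left-hand side of the joint bound. -/
def jointMatrix : Matrix (Σ i, (Fin (D₁ i).v ⊕ Fin (D₁ i).u) ⊕ (Fin (D₂ i).v ⊕ Fin (D₂ i).u))
    (Σ i, (Fin (D₁ i).v ⊕ Fin (D₁ i).u) ⊕ (Fin (D₂ i).v ⊕ Fin (D₂ i).u)) ℝ :=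
  (globalT D₁ D₂)ᵀ *
      (symLaplacian G r ⊗ₖ (1 : Matrix (Fin n₁ ⊕ Fin n₂) (Fin n₁ ⊕ Fin n₂) ℝ)) *
      globalT D₁ D₂ +
    Matrix.blockDiagonal' (fun i => r i • extendObs (Y i) 0)

theorem globalT_mulVec
    (z : (Σ i, (Fin (D₁ i).v ⊕ Fin (D₁ i).u) ⊕ (Fin (D₂ i).v ⊕ Fin (D₂ i).u)) → ℝ)
    (i : Fin N) (a : Fin n₁ ⊕ Fin n₂) :
    (globalT D₁ D₂ *ᵥ z) (i, a) = (localT (D₁ i) (D₂ i) *ᵥ fun b => z ⟨i, b⟩) a := by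
  rw [mulVec, dotProduct, Fintype.sum_sigma, Finset.sum_eq_single i]
  · simp [globalT, mulVec, dotProduct]
  · intro j _ hj
    simp [globalT, hj.symm]
  · simp

theorem dotProduct_sigma {κ : Fin N → Type*} [∀ i, Fintype (κ i)] (y z : (Σ i, κ i) → ℝ) :
    y ⬝ᵥ z = ∑ i, (fun a => y ⟨i, a⟩) ⬝ᵥ (fun a => z ⟨i, a⟩) :=
  Fintype.sum_sigma _

theorem dotProduct_prod {κ : Type*} [Fintype κ] (y z : Fin N × κ → ℝ) :
    y ⬝ᵥ z = ∑ i, (fun a => y (i, a)) ⬝ᵥ (fun a => z (i, a)) :=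
  Fintype.sum_prod_type _

theorem blockDiagonal'_mulVec {κ : Fin N → Type*} [∀ i, Fintype (κ i)]
    (M : ∀ i, Matrix (κ i) (κ i) ℝ) (z : (Σ i, κ i) → ℝ) (i : Fin N) :
    (fun a => (Matrix.blockDiagonal' M *ᵥ z) ⟨i, a⟩) = M i *ᵥ fun b => z ⟨i, b⟩ := by
  funext a
  rw [mulVec, dotProduct, Fintype.sum_sigma, Finset.sum_eq_single i]
  · simp [Matrix.blockDiagonal'_apply, mulVec, dotProduct]
  · intro j _ hj
    simp [Matrix.blockDiagonal'_apply, hj.symm]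
  · simp

theorem kronecker_one_mulVec {κ : Type*} [Fintype κ] [DecidableEq κ]
    (L : Matrix (Fin N) (Fin N) ℝ) (w : Fin N × κ → ℝ) (i : Fin N) :
    (fun a => ((L ⊗ₖ (1 : Matrix κ κ ℝ)) *ᵥ w) (i, a)) = ∑ j, L i j • fun a => w (j, a) := by
  funext a
  rw [mulVec, dotProduct, Fintype.sum_prod_type, Finset.sum_apply]
  simp [Matrix.one_apply]

/-- The Laplacian couples the vectors `T_i z_i`, expressed in coordinates common to all agents,
while `Y_i` acts in the agent's own coordinates. -/
theorem jointMatrix_quadForm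
    (z : (Σ i, (Fin (D₁ i).v ⊕ Fin (D₁ i).u) ⊕ (Fin (D₂ i).v ⊕ Fin (D₂ i).u)) → ℝ) :
    z ⬝ᵥ jointMatrix D₁ D₂ G r Y *ᵥ z =
      ∑ i, ∑ j, symLaplacian G r i j *
        ((localT (D₁ i) (D₂ i) *ᵥ fun b => z ⟨i, b⟩) ⬝ᵥ
          (localT (D₁ j) (D₂ j) *ᵥ fun b => z ⟨j, b⟩)) +
      ∑ i, r i * (obsPart (fun b => z ⟨i, b⟩) ⬝ᵥ Y i *ᵥ obsPart (fun b => z ⟨i, b⟩)) := by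
  rw [jointMatrix, add_mulVec, dotProduct_add]
  congr 1
  · rw [← mulVec_mulVec, ← mulVec_mulVec, dotProduct_mulVec, vecMul_transpose, dotProduct_prod]
    refine Finset.sum_congr rfl fun i _ => ?_
    rw [kronecker_one_mulVec, dotProduct_sum]
    refine Finset.sum_congr rfl fun j _ => ?_
    rw [dotProduct_smul, smul_eq_mul]
    simp only [globalT_mulVec]
  · rw [dotProduct_sigma]
    refine Finset.sum_congr rfl fun i _ => ?_
    have hb := blockDiagonal'_mulVec
      (κ := fun i => (Fin (D₁ i).v ⊕ Fin (D₁ i).u) ⊕ (Fin (D₂ i).v ⊕ Fin (D₂ i).u))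
      (fun i => r i • extendObs (Y i) 0) z i
    rw [hb, smul_mulVec, dotProduct_smul, dotProduct_extendObs_mulVec,
      smul_eq_mul, zero_mul, add_zero]

theorem jointMatrix_transpose (hY : ∀ i, (Y i).PosDef) :
    (jointMatrix D₁ D₂ G r Y)ᵀ = jointMatrix D₁ D₂ G r Y := by
  have h1 : (symLaplacian G r ⊗ₖ (1 : Matrix (Fin n₁ ⊕ Fin n₂) (Fin n₁ ⊕ Fin n₂) ℝ))ᵀ =
      symLaplacian G r ⊗ₖ (1 : Matrix (Fin n₁ ⊕ Fin n₂) (Fin n₁ ⊕ Fin n₂) ℝ) := by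
    rw [← kroneckerMap_transpose, symLaplacian_transpose, transpose_one]
  have h2 : (fun i => (r i • extendObs (b := (D₁ i).u) (d := (D₂ i).u) (Y i) 0)ᵀ) =
      fun i => r i • extendObs (b := (D₁ i).u) (d := (D₂ i).u) (Y i) 0 := by
    funext i
    rw [transpose_smul, extendObs_transpose, (hY i).transpose_eq]
  rw [jointMatrix, transpose_add, blockDiagonal'_transpose, h2, transpose_mul, transpose_mul, h1,
    transpose_transpose, Matrix.mul_assoc]

/-- Both parts of the form are nonnegative. If both vanish, the `T_i z_i` agree and each has zero
observable coordinates; the common vector is then purely slow and unobservable for every agent,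
hence zero. -/
theorem jointMatrix_posDef {r : Fin N → ℝ} (hG : IsStronglyConnected G) (hr : IsLeftWeight G r)
    (hY : ∀ i, (Y i).PosDef)
    (hobs : ∀ v : Fin n₁ → ℝ, (∀ i, ∀ k : ℕ, C₁ i *ᵥ (A₁ ^ k *ᵥ v) = 0) → v = 0)
    (hu : ∀ i, (D₂ i).u = 0) : (jointMatrix D₁ D₂ G r Y).PosDef := by
  refine Matrix.PosDef.of_dotProduct_mulVec_pos
    (by rw [Matrix.IsHermitian, conjTranspose_eq_transpose_of_trivial,
      jointMatrix_transpose D₁ D₂ G r Y hY]) fun z hz => ?_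
  rw [star_trivial, jointMatrix_quadForm]
  have h1 := sum_symLaplacian_nonneg hr fun i => localT (D₁ i) (D₂ i) *ᵥ fun b => z ⟨i, b⟩
  have hYnn : ∀ i, 0 ≤ obsPart (fun b => z ⟨i, b⟩) ⬝ᵥ Y i *ᵥ obsPart (fun b => z ⟨i, b⟩) := by
    intro i
    simpa using (hY i).posSemidef.dotProduct_mulVec_nonneg (obsPart (fun b => z ⟨i, b⟩))
  have h2 : 0 ≤ ∑ i, r i * (obsPart (fun b => z ⟨i, b⟩) ⬝ᵥ Y i *ᵥ obsPart (fun b => z ⟨i, b⟩)) :=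
    Finset.sum_nonneg fun i _ => mul_nonneg (hr.1 i).le (hYnn i)
  refine lt_of_le_of_ne (add_nonneg h1 h2) fun h => hz ?_
  rw [eq_comm, add_eq_zero_iff_of_nonneg h1 h2] at h
  have hcons := eq_of_sum_symLaplacian_eq_zero hG hr h.1
  have hobs0 : ∀ i, obsPart (fun b => z ⟨i, b⟩) = 0 := by
    intro i
    by_contra hne
    have h3 := (Finset.sum_eq_zero_iff_of_nonneg
      fun i _ => mul_nonneg (hr.1 i).le (hYnn i)).1 h.2 i (Finset.mem_univ i)
    exact (mul_pos (hr.1 i) ((hY i).dotProduct_pos hne)).ne' h3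
  have hw : ∀ i, (localT (D₁ i) (D₂ i) *ᵥ fun b => z ⟨i, b⟩) =
      Sum.elim ((D₁ i).T *ᵥ Sum.elim 0 fun k => z ⟨i, Sum.inl (Sum.inr k)⟩) 0 := by
    intro i
    have hl : (fun b => z ⟨i, b⟩) ∘ Sum.inl =
        Sum.elim (0 : Fin (D₁ i).v → ℝ) fun k => z ⟨i, Sum.inl (Sum.inr k)⟩ := by
      funext k
      rcases k with k | k
      · exact congrFun (hobs0 i) (Sum.inl k)
      · rfl
    have hr : (fun b => z ⟨i, b⟩) ∘ Sum.inr = 0 := by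
      funext k
      rcases k with k | k
      · exact congrFun (hobs0 i) (Sum.inr k)
      · exact (Fin.cast (hu i) k).elim0
    rw [localT, fromBlocks_mulVec, hl, hr]
    simp
  funext ⟨i, b⟩
  have hzero : (D₁ i).T *ᵥ (Sum.elim 0 fun k => z ⟨i, Sum.inl (Sum.inr k)⟩) = 0 := by
    refine hobs _ fun j k => ?_
    have h4 := hcons i j
    rw [hw, hw] at h4
    have h5 := congrArg (fun f => f ∘ Sum.inl) h4
    simp only [Sum.elim_comp_inl] at h5
    -- The vector written in the coordinates of agent `i` is rewritten in those of agent `j`, where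
    -- it is visibly unobservable for `j`.
    rw [h5]
    exact (D₁ j).unobservable _ k
  have h6 := hw i
  rw [hzero] at h6
  exact congrFun (localT_mulVec_eq_zero _ _ (h6.trans (by funext k; rcases k <;> rfl))) b

end Joint

/-! ### The local error dynamics in observability coordinates -/

section LocalDynamics

variable {q n₁ n₂ : ℕ} {C₁ : Matrix (Fin q) (Fin n₁) ℝ} {A₁ : Matrix (Fin n₁) (Fin n₁) ℝ}
  {C₂ : Matrix (Fin q) (Fin n₂) ℝ} {N₂ : Matrix (Fin n₂) (Fin n₂) ℝ}
  (D₁ : ObsDecomp C₁ A₁) (D₂ : ObsDecomp C₂ N₂)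
  (H₁ : Matrix (Fin D₁.v) (Fin q) ℝ) (H₂ : Matrix (Fin D₂.v) (Fin q) ℝ)

/-- `diag (I, Tᵀ N₂ T)` in observability coordinates. -/
def fullEo : Matrix ((Fin D₁.v ⊕ Fin D₁.u) ⊕ (Fin D₂.v ⊕ Fin D₂.u))
    ((Fin D₁.v ⊕ Fin D₁.u) ⊕ (Fin D₂.v ⊕ Fin D₂.u)) ℝ :=
  fromBlocks 1 0 0 (fromBlocks D₂.Ao 0 D₂.Ar D₂.Au)

/-- The matrix `diag (Tᵀ A₁ T, I)` in observability coordinates. -/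
def fullAo : Matrix ((Fin D₁.v ⊕ Fin D₁.u) ⊕ (Fin D₂.v ⊕ Fin D₂.u))
    ((Fin D₁.v ⊕ Fin D₁.u) ⊕ (Fin D₂.v ⊕ Fin D₂.u)) ℝ :=
  fromBlocks (fromBlocks D₁.Ao 0 D₁.Ar D₁.Au) 0 0 1

/-- The output matrix in observability coordinates. -/
def fullCo : Matrix (Fin q) ((Fin D₁.v ⊕ Fin D₁.u) ⊕ (Fin D₂.v ⊕ Fin D₂.u)) ℝ :=
  fromCols (fromCols D₁.Co 0) (fromCols D₂.Co 0)

/-- The observer gain in observability coordinates. -/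
def fullHo : Matrix ((Fin D₁.v ⊕ Fin D₁.u) ⊕ (Fin D₂.v ⊕ Fin D₂.u)) (Fin q) ℝ :=
  fromRows (fromRows H₁ 0) (fromRows H₂ 0)

/-- The closed-loop matrix in observability coordinates. -/
def fullAcl : Matrix ((Fin D₁.v ⊕ Fin D₁.u) ⊕ (Fin D₂.v ⊕ Fin D₂.u))
    ((Fin D₁.v ⊕ Fin D₁.u) ⊕ (Fin D₂.v ⊕ Fin D₂.u)) ℝ :=
  fullAo D₁ D₂ - fullHo D₁ D₂ H₁ H₂ * fullCo D₁ D₂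

variable (z : (Fin D₁.v ⊕ Fin D₁.u) ⊕ (Fin D₂.v ⊕ Fin D₂.u) → ℝ)

/-- By block triangularity the observable coordinates evolve autonomously; `obsPart_fullAcl` is the
counterpart for the closed loop. -/
theorem obsPart_fullEo : obsPart (fullEo D₁ D₂ *ᵥ z) = localEo D₁ D₂ *ᵥ obsPart z := by
  funext k
  rcases k with k | k
  · simp [fullEo, localEo, fromBlocks_mulVec]
  · simp [fullEo, localEo, fromBlocks_mulVec]
    rfl

theorem fullEo_slow (k : Fin D₁.v ⊕ Fin D₁.u) :
    (fullEo D₁ D₂ *ᵥ z) (Sum.inl k) = z (Sum.inl k) := by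
  simp [fullEo, fromBlocks_mulVec]

theorem fullCo_mulVec : fullCo D₁ D₂ *ᵥ z = fromCols D₁.Co D₂.Co *ᵥ obsPart z := by
  rw [fullCo, fromCols_mulVec, fromCols_mulVec, fromCols_mulVec, fromCols_mulVec]
  simp only [zero_mulVec, add_zero]
  rfl

theorem obsPart_fullAcl :
    obsPart (fullAcl D₁ D₂ H₁ H₂ *ᵥ z) = localAcl D₁ D₂ H₁ H₂ *ᵥ obsPart z := by
  rw [fullAcl, localAcl, sub_mulVec, sub_mulVec, ← mulVec_mulVec, ← mulVec_mulVec, fullCo_mulVec]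
  funext k
  rcases k with k | k
  · simp [fullAo, fullHo, fromBlocks_mulVec, fromRows_mulVec]
    rfl
  · simp [fullAo, fullHo, fromBlocks_mulVec, fromRows_mulVec]

theorem fullAcl_slow_unobs (k : Fin D₁.u) :
    (fullAcl D₁ D₂ H₁ H₂ *ᵥ z) (Sum.inl (Sum.inr k)) =
      (D₁.Ar *ᵥ (z ∘ Sum.inl ∘ Sum.inl) + D₁.Au *ᵥ (z ∘ Sum.inl ∘ Sum.inr)) k := by
  rw [fullAcl, sub_mulVec, ← mulVec_mulVec]
  simp [fullAo, fullHo, fromBlocks_mulVec, fromRows_mulVec]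
  rfl

theorem dotProduct_symPart_mulVec {κ : Type*} [Fintype κ] (M : Matrix κ κ ℝ) (v : κ → ℝ) :
    v ⬝ᵥ symPart M *ᵥ v = 2 * (v ⬝ᵥ M *ᵥ v) := by
  rw [symPart, add_mulVec, dotProduct_add, dotProduct_mulVec v Mᵀ, vecMul_transpose,
    dotProduct_comm (M *ᵥ v), two_mul]

/-- The quadratic form of `[0, Arᵀ; Ar, sym Au]`. -/
theorem localYu_quadForm (s : Fin D₁.v ⊕ Fin D₁.u → ℝ) :
    s ⬝ᵥ localYu D₁ *ᵥ s =
      2 * ((s ∘ Sum.inr) ⬝ᵥ (D₁.Ar *ᵥ (s ∘ Sum.inl) + D₁.Au *ᵥ (s ∘ Sum.inr))) := by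
  rw [localYu, fromBlocks_mulVec, dotProduct_block, Sum.elim_comp_inl, Sum.elim_comp_inr,
    zero_mulVec, zero_add, dotProduct_add, dotProduct_symPart_mulVec,
    dotProduct_mulVec _ D₁.Arᵀ, vecMul_transpose, dotProduct_comm (D₁.Ar *ᵥ _), dotProduct_add]
  ring

/-- The Lyapunov equation in terms of the full local dynamics. -/
theorem local_lyapunov (hu : D₂.u = 0)
    {Wo Y : Matrix (Fin D₁.v ⊕ Fin D₂.v) (Fin D₁.v ⊕ Fin D₂.v) ℝ} {γ : ℝ}
    (hW : symPart ((localEo D₁ D₂)ᵀ * Wo * localAcl D₁ D₂ H₁ H₂) =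
      -(γ • ((localEo D₁ D₂)ᵀ * Y * localEo D₁ D₂))) :
    2 * ((fullEo D₁ D₂ *ᵥ z) ⬝ᵥ extendObs Wo 1 *ᵥ (fullAcl D₁ D₂ H₁ H₂ *ᵥ z)) =
      -γ * (obsPart (fullEo D₁ D₂ *ᵥ z) ⬝ᵥ Y *ᵥ obsPart (fullEo D₁ D₂ *ᵥ z)) +
        ((fullEo D₁ D₂ *ᵥ z) ∘ Sum.inl) ⬝ᵥ localYu D₁ *ᵥ ((fullEo D₁ D₂ *ᵥ z) ∘ Sum.inl) := by
  -- `E` is the identity on slow coordinates, so the drift of the slow unobservable part can be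
  -- expressed through `E z` alone. The next fact discards the fast unobservable sum, which is
  -- empty.
  have hs : (fullEo D₁ D₂ *ᵥ z) ∘ Sum.inl = z ∘ Sum.inl := funext fun k => fullEo_slow D₁ D₂ z k
  have hd : ∑ k, (fullEo D₁ D₂ *ᵥ z) (Sum.inr (Sum.inr k)) *
      (fullAcl D₁ D₂ H₁ H₂ *ᵥ z) (Sum.inr (Sum.inr k)) = 0 :=
    Finset.sum_eq_zero fun k _ => (Fin.cast hu k).elim0
  have h1 := dotProduct_symPart_mulVec ((localEo D₁ D₂)ᵀ * Wo * localAcl D₁ D₂ H₁ H₂) (obsPart z)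
  have hconj : ∀ M B : Matrix (Fin D₁.v ⊕ Fin D₂.v) (Fin D₁.v ⊕ Fin D₂.v) ℝ,
      obsPart z ⬝ᵥ ((localEo D₁ D₂)ᵀ * M * B) *ᵥ obsPart z =
        (localEo D₁ D₂ *ᵥ obsPart z) ⬝ᵥ M *ᵥ (B *ᵥ obsPart z) := by
    intro M B
    rw [← mulVec_mulVec, ← mulVec_mulVec, dotProduct_mulVec, vecMul_transpose]
  rw [hW, neg_mulVec, smul_mulVec, dotProduct_neg, dotProduct_smul, hconj, hconj, smul_eq_mul]
    at h1
  rw [dotProduct_extendObs_mulVec, hd, hs, localYu_quadForm, obsPart_fullEo, obsPart_fullAcl,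
    mul_add, ← h1]
  simp only [fullAcl_slow_unobs, fullEo_slow, one_mul, add_zero, neg_mul]
  rfl

/-- Slow coordinates vanish with `E v`, fast observable ones by the local hypothesis, and no others
remain. -/
theorem fullAcl_isIndexOne (hu : D₂.u = 0)
    (h : IsIndexOne (localEo D₁ D₂) (localAcl D₁ D₂ H₁ H₂)) :
    IsIndexOne (fullEo D₁ D₂) (fullAcl D₁ D₂ H₁ H₂) := by
  intro v w hv hw
  have h0 : obsPart v = 0 := by
    refine h _ (obsPart w) ?_ ?_
    · rw [← obsPart_fullEo, hv]; rfl
    · rw [← obsPart_fullEo, ← obsPart_fullAcl, hw]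
  funext k
  rcases k with k | (k | k)
  · rw [← fullEo_slow D₁ D₂ v k, hv]
  · exact congrFun h0 (Sum.inr k)
  · exact (Fin.cast hu k).elim0

theorem localT_mul_fullEo :
    localT D₁ D₂ * fullEo D₁ D₂ =
      (fromBlocks 1 0 0 N₂ : Matrix (Fin n₁ ⊕ Fin n₂) (Fin n₁ ⊕ Fin n₂) ℝ) * localT D₁ D₂ := by
  rw [localT, fullEo, fromBlocks_multiply, fromBlocks_multiply]
  simp [D₂.mul_T]

theorem localT_mul_fullAo :
    localT D₁ D₂ * fullAo D₁ D₂ =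
      (fromBlocks A₁ 0 0 1 : Matrix (Fin n₁ ⊕ Fin n₂) (Fin n₁ ⊕ Fin n₂) ℝ) * localT D₁ D₂ := by
  rw [localT, fullAo, fromBlocks_multiply, fromBlocks_multiply]
  simp [D₁.mul_T]

theorem fromCols_mul_localT : fromCols C₁ C₂ * localT D₁ D₂ = fullCo D₁ D₂ := by
  rw [localT, fullCo, fromCols_mul_fromBlocks]
  simp [D₁.C_eq, D₂.C_eq]

end LocalDynamics

/-! ### One agent: from original to observability coordinates -/

section Agent

variable {ι : Type*} [Fintype ι] [DecidableEq ι] {E A : Matrix ι ι ℝ} (S : StdForm E A) {q : ℕ}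
  {C : Matrix (Fin q) ι ℝ} (D₁ : ObsDecomp (S.C₁ C) S.A₁) (D₂ : ObsDecomp (S.C₂ C) S.N₂)
  (H₁ : Matrix (Fin D₁.v) (Fin q) ℝ) (H₂ : Matrix (Fin D₂.v) (Fin q) ℝ)

/-- The observability coordinates of one agent. -/
def coords (v : ι → ℝ) : (Fin D₁.v ⊕ Fin D₁.u) ⊕ (Fin D₂.v ⊕ Fin D₂.u) → ℝ :=
  (localT D₁ D₂)ᵀ *ᵥ (S.Pinv *ᵥ v)

theorem localT_mulVec_coords (v : ι → ℝ) : localT D₁ D₂ *ᵥ coords S D₁ D₂ v = S.Pinv *ᵥ v := by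
  rw [coords, mulVec_mulVec, localT_mul_transpose, one_mulVec]

theorem eq_zero_of_coords {v : ι → ℝ} (h : coords S D₁ D₂ v = 0) : v = 0 := by
  rw [← S.mulVec_P_Pinv v, ← localT_mulVec_coords S D₁ D₂, h, mulVec_zero, mulVec_zero]

theorem localT_transpose_mulVec_localT_mulVec
    (y : (Fin D₁.v ⊕ Fin D₁.u) ⊕ (Fin D₂.v ⊕ Fin D₂.u) → ℝ) :
    (localT D₁ D₂)ᵀ *ᵥ (localT D₁ D₂ *ᵥ y) = y := by
  rw [mulVec_mulVec, localT_transpose_mul, one_mulVec]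

/-- States are read through `Tᵀ P⁻¹` and equations through `Tᵀ Q`; with these two changes `E`, `A`
and `C` take their decomposed forms. -/
theorem Q_mulVec_E (v : ι → ℝ) :
    S.Q *ᵥ (E *ᵥ v) = localT D₁ D₂ *ᵥ (fullEo D₁ D₂ *ᵥ coords S D₁ D₂ v) := by
  rw [mulVec_mulVec, S.Q_mul_E, ← mulVec_mulVec, ← localT_mulVec_coords S D₁ D₂, mulVec_mulVec,
    mulVec_mulVec, localT_mul_fullEo]

theorem Q_mulVec_A (v : ι → ℝ) :
    S.Q *ᵥ (A *ᵥ v) = localT D₁ D₂ *ᵥ (fullAo D₁ D₂ *ᵥ coords S D₁ D₂ v) := by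
  rw [mulVec_mulVec, S.Q_mul_A, ← mulVec_mulVec, ← localT_mulVec_coords S D₁ D₂, mulVec_mulVec,
    mulVec_mulVec, localT_mul_fullAo]

theorem C_mulVec (v : ι → ℝ) : C *ᵥ v = fullCo D₁ D₂ *ᵥ coords S D₁ D₂ v := by
  rw [← fromCols_mul_localT, ← mulVec_mulVec, localT_mulVec_coords, StdForm.C₁, StdForm.C₂,
    fromCols_toCols, mulVec_mulVec, Matrix.mul_assoc, S.P_mul_Pinv, Matrix.mul_one]

theorem Q_mul_gainH : S.Q * gainH S D₁ D₂ H₁ H₂ = localT D₁ D₂ * fullHo D₁ D₂ H₁ H₂ := by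
  rw [gainH, ← Matrix.mul_assoc, S.Q_mul_Qinv, Matrix.one_mul, localT, fullHo,
    fromBlocks_mul_fromRows]
  simp

theorem Q_mulVec_closedLoop (v : ι → ℝ) :
    S.Q *ᵥ ((A - gainH S D₁ D₂ H₁ H₂ * C) *ᵥ v) =
      localT D₁ D₂ *ᵥ (fullAcl D₁ D₂ H₁ H₂ *ᵥ coords S D₁ D₂ v) := by
  rw [sub_mulVec, mulVec_sub, Q_mulVec_A S D₁ D₂, fullAcl, sub_mulVec, mulVec_sub,
    ← mulVec_mulVec, C_mulVec S D₁ D₂, mulVec_mulVec _ S.Q, Q_mul_gainH]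
  simp only [mulVec_mulVec, Matrix.mul_assoc]

theorem closedLoop_isIndexOne (hu : D₂.u = 0)
    (h : IsIndexOne (localEo D₁ D₂) (localAcl D₁ D₂ H₁ H₂)) :
    IsIndexOne E (A - gainH S D₁ D₂ H₁ H₂ * C) := by
  intro v w hv hw
  refine eq_zero_of_coords S D₁ D₂
    (fullAcl_isIndexOne D₁ D₂ H₁ H₂ hu h _ (coords S D₁ D₂ w) ?_ ?_)
  · exact localT_mulVec_eq_zero D₁ D₂ (by rw [← Q_mulVec_E, hv, mulVec_zero])
  · rw [← localT_transpose_mulVec_localT_mulVec S D₁ D₂ (fullAcl D₁ D₂ H₁ H₂ *ᵥ _),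
      ← Q_mulVec_closedLoop, hw, Q_mulVec_E S D₁ D₂,
      localT_transpose_mulVec_localT_mulVec S D₁ D₂]

variable {Wo : Matrix (Fin D₁.v ⊕ Fin D₂.v) (Fin D₁.v ⊕ Fin D₂.v) ℝ}

theorem Q_mul_weightW : S.Q * weightW S D₁ D₂ Wo =
    localT D₁ D₂ * extendObs (b := D₁.u) (d := D₂.u) Wo 1 * (localT D₁ D₂)ᵀ * S.Q := by
  rw [weightW, ← Matrix.mul_assoc, ← Matrix.mul_assoc, S.Q_mul_Qinv, Matrix.one_mul]

/-- `W` is similar to the positive definite `W̃`; the inverse is `Q⁻¹ T W̃⁻¹ Tᵀ Q`. -/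
theorem isUnit_det_weightW (hW : Wo.PosDef) : IsUnit (weightW S D₁ D₂ Wo).det := by
  have h1 := (Matrix.isUnit_iff_isUnit_det _).1
    (extendObs_one_posDef (b := D₁.u) (d := D₂.u) hW).isUnit
  refine Matrix.isUnit_det_of_right_inverse (B := S.Qinv *
    (localT D₁ D₂ * ((extendObs (b := D₁.u) (d := D₂.u) Wo 1)⁻¹ * ((localT D₁ D₂)ᵀ * S.Q)))) ?_
  simp only [weightW, Matrix.mul_assoc]
  rw [← Matrix.mul_assoc S.Q S.Qinv, S.Q_mul_Qinv, Matrix.one_mul,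
    ← Matrix.mul_assoc (localT D₁ D₂)ᵀ (localT D₁ D₂), localT_transpose_mul, Matrix.one_mul,
    Matrix.mul_nonsing_inv_cancel_left _ _ h1, ← Matrix.mul_assoc (localT D₁ D₂),
    localT_mul_transpose, Matrix.one_mul, S.Qinv_mul_Q]

/-- The Lyapunov matrix `Qᵀ Q W` of one agent. -/
def lyapM (Wo : Matrix (Fin D₁.v ⊕ Fin D₂.v) (Fin D₁.v ⊕ Fin D₂.v) ℝ) : Matrix ι ι ℝ :=
  S.Qᵀ * (S.Q * weightW S D₁ D₂ Wo)

theorem StdForm.Q_mulVec_injective : Function.Injective S.Q.mulVec :=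
  Function.LeftInverse.injective (g := S.Qinv.mulVec) fun v => by
    rw [mulVec_mulVec, S.Qinv_mul_Q, one_mulVec]

theorem StdForm.posDef_transpose_mul_self : (S.Qᵀ * S.Q).PosDef := by
  simpa using (Matrix.PosDef.one (n := Fin S.n₁ ⊕ Fin S.n₂) (R := ℝ)).conjTranspose_mul_mul_same
    S.Q_mulVec_injective

theorem mulVec_dotProduct_eq {κ κ' : Type*} [Fintype κ] [Fintype κ'] (B : Matrix κ' κ ℝ)
    (v : κ → ℝ) (w : κ' → ℝ) : (B *ᵥ v) ⬝ᵥ w = v ⬝ᵥ Bᵀ *ᵥ w := by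
  rw [dotProduct_mulVec, vecMul_transpose]

/-- `Qᵀ Q W` equals `(Tᵀ Q)ᵀ W̃ (Tᵀ Q)`, a congruence of `W̃`. -/
theorem lyapM_posDef (hW : Wo.PosDef) : (lyapM S D₁ D₂ Wo).PosDef := by
  have h1 : Function.Injective ((localT D₁ D₂)ᵀ * S.Q).mulVec :=
    Function.LeftInverse.injective (g := (S.Qinv * localT D₁ D₂).mulVec) fun v => by
      rw [mulVec_mulVec, Matrix.mul_assoc, ← Matrix.mul_assoc (localT D₁ D₂),
        localT_mul_transpose, Matrix.one_mul, S.Qinv_mul_Q, one_mulVec]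
  have h2 := (extendObs_one_posDef (b := D₁.u) (d := D₂.u) hW).conjTranspose_mul_mul_same h1
  rw [conjTranspose_eq_transpose_of_trivial, transpose_mul, transpose_transpose] at h2
  rw [lyapM, Q_mul_weightW]
  simpa only [Matrix.mul_assoc] using h2

theorem dotProduct_lyapM (v w : ι → ℝ) :
    v ⬝ᵥ lyapM S D₁ D₂ Wo *ᵥ w = ((localT D₁ D₂)ᵀ *ᵥ (S.Q *ᵥ v)) ⬝ᵥ
      extendObs Wo 1 *ᵥ ((localT D₁ D₂)ᵀ *ᵥ (S.Q *ᵥ w)) := by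
  rw [lyapM, Q_mul_weightW, mulVec_dotProduct_eq, mulVec_dotProduct_eq, transpose_transpose]
  simp only [mulVec_mulVec, Matrix.mul_assoc]

/-- The agent-dependent weight cancels against the `W⁻¹` of the coupling. Only the common form `Qᵀ
Q` remains, so the coupling terms of different agents combine into one Laplacian form. -/
theorem dotProduct_lyapM_inv (hW : Wo.PosDef) (v w : ι → ℝ) :
    v ⬝ᵥ lyapM S D₁ D₂ Wo *ᵥ ((weightW S D₁ D₂ Wo)⁻¹ *ᵥ w) = (S.Q *ᵥ v) ⬝ᵥ (S.Q *ᵥ w) := by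
  rw [lyapM, mulVec_mulVec, Matrix.mul_assoc, Matrix.mul_assoc,
    Matrix.mul_nonsing_inv _ (isUnit_det_weightW S D₁ D₂ hW), Matrix.mul_one, ← mulVec_mulVec,
    dotProduct_mulVec, vecMul_transpose]

end Agent

/-! ### The global error dynamics -/

theorem dotProduct_mulVec_le_maxSingularValue {κ : Type*} [Fintype κ] [DecidableEq κ]
    (M : Matrix κ κ ℝ) (v : κ → ℝ) : v ⬝ᵥ M *ᵥ v ≤ maxSingularValue M * (v ⬝ᵥ v) := by
  have h1 : v ⬝ᵥ M *ᵥ v = inner ℝ (WithLp.toLp 2 v) (Matrix.toEuclideanCLM (𝕜 := ℝ) M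
      (WithLp.toLp 2 v)) := by
    rw [Matrix.toEuclideanCLM_toLp, EuclideanSpace.inner_toLp_toLp, star_trivial, dotProduct_comm]
  have h2 : v ⬝ᵥ v = ‖WithLp.toLp 2 v‖ * ‖WithLp.toLp 2 v‖ := by
    rw [← real_inner_self_eq_norm_mul_norm, EuclideanSpace.inner_toLp_toLp, star_trivial]
  rw [h1, h2, maxSingularValue]
  refine (real_inner_le_norm _ _).trans ?_
  have h3 := (Matrix.toEuclideanCLM (𝕜 := ℝ) M).le_opNorm (WithLp.toLp 2 v)
  nlinarith [mul_le_mul_of_nonneg_left h3 (norm_nonneg (WithLp.toLp 2 v))]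

theorem maxSingularValue_nonneg {κ : Type*} [Fintype κ] [DecidableEq κ] (M : Matrix κ κ ℝ) :
    0 ≤ maxSingularValue M := norm_nonneg _

/-! ### Block diagonal matrices over the agents -/

section BlockDiagonal

variable {N : ℕ} {κ : Type*} [Fintype κ] [DecidableEq κ]

/-- The block diagonal matrix with blocks `B i`, the block index coming first. -/
def prodDiagonal (B : Fin N → Matrix κ κ ℝ) : Matrix (Fin N × κ) (Fin N × κ) ℝ :=
  Matrix.of fun a b => if a.1 = b.1 then B a.1 a.2 b.2 else 0

theorem prodDiagonal_mulVec (B : Fin N → Matrix κ κ ℝ) (v : Fin N × κ → ℝ) (i : Fin N) :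
    (fun a => (prodDiagonal B *ᵥ v) (i, a)) = B i *ᵥ fun a => v (i, a) := by
  funext a
  rw [mulVec, dotProduct, Fintype.sum_prod_type, Finset.sum_eq_single i]
  · simp [prodDiagonal, mulVec, dotProduct]
  · intro j _ hj
    simp [prodDiagonal, hj.symm]
  · simp

theorem prodDiagonal_posDef {B : Fin N → Matrix κ κ ℝ} (hB : ∀ i, (B i).PosDef) :
    (prodDiagonal B).PosDef := by
  refine Matrix.PosDef.of_dotProduct_mulVec_pos ?_ fun v hv => ?_
  · ext ⟨i, a⟩ ⟨j, b⟩
    by_cases h : i = j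
    · subst h
      simpa [prodDiagonal] using congrFun (congrFun (hB i).transpose_eq a) b
    · simp [prodDiagonal, h, Ne.symm h]
  · have hnn : ∀ i, 0 ≤ (fun a => v (i, a)) ⬝ᵥ B i *ᵥ fun a => v (i, a) := fun i => by
      simpa using (hB i).posSemidef.dotProduct_mulVec_nonneg (fun a => v (i, a))
    rw [star_trivial, dotProduct_prod]
    simp only [prodDiagonal_mulVec]
    obtain ⟨⟨i, a⟩, hia⟩ := Function.ne_iff.1 hv
    exact Finset.sum_pos' (fun i _ => hnn i) ⟨i, Finset.mem_univ i,
      (hB i).dotProduct_pos fun h => hia (congrFun h a)⟩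

end BlockDiagonal

/-! ### Error dynamics of the network -/

section ErrorDynamics

variable {N n : ℕ} {p : Fin N → ℕ} (E A : Matrix (Fin n) (Fin n) ℝ)
  (C : Matrix (Σ i, Fin (p i)) (Fin n) ℝ) (G : Digraph (Fin N)) [DecidableRel G.Adj]
  (H : ∀ i, Matrix (Fin n) (Fin (p i)) ℝ) (W : Fin N → Matrix (Fin n) (Fin n) ℝ) (γ : ℝ)

theorem errorE_mulVec (v : Fin N × Fin n → ℝ) (i : Fin N) :
    (fun a => (errorE N E *ᵥ v) (i, a)) = E *ᵥ fun a => v (i, a) := by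
  have : errorE N E = prodDiagonal fun _ => E := by
    ext ⟨i, a⟩ ⟨j, b⟩
    simp [errorE, prodDiagonal, Matrix.one_apply]
  rw [this, prodDiagonal_mulVec]

theorem errorA_mulVec (v : Fin N × Fin n → ℝ) (i : Fin N) :
    (fun a => (errorA E A C G H W γ *ᵥ v) (i, a)) =
      (A - H i * localOutput C i) *ᵥ (fun a => v (i, a)) -
        γ • ((W i)⁻¹ *ᵥ ∑ j, digraphLaplacian G i j • (E *ᵥ fun a => v (j, a))) := by
  have h1 : errorA E A C G H W γ = prodDiagonal (fun i => A - H i * localOutput C i) -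
      Matrix.of fun a b => γ * digraphLaplacian G a.1 b.1 * ((W a.1)⁻¹ * E) a.2 b.2 := rfl
  have h2 : (fun a => ((Matrix.of fun a b : Fin N × Fin n =>
      γ * digraphLaplacian G a.1 b.1 * ((W a.1)⁻¹ * E) a.2 b.2) *ᵥ v) (i, a)) =
        γ • ((W i)⁻¹ *ᵥ ∑ j, digraphLaplacian G i j • (E *ᵥ fun a => v (j, a))) := by
    funext a
    rw [mulVec_sum, Pi.smul_apply, Finset.sum_apply, smul_eq_mul, Finset.mul_sum, mulVec,
      dotProduct, Fintype.sum_prod_type]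
    refine Finset.sum_congr rfl fun j _ => ?_
    rw [mulVec_smul, mulVec_mulVec, Pi.smul_apply, smul_eq_mul, ← mul_assoc, mulVec, dotProduct,
      Finset.mul_sum]
    exact Finset.sum_congr rfl fun b _ => by rw [Matrix.of_apply, mul_assoc]
  rw [← prodDiagonal_mulVec (fun i => A - H i * localOutput C i), ← h2, h1, sub_mulVec]
  rfl

/-- The error dynamics have index one if all local closed loops have: on the kernel of `I ⊗ E` the
coupling vanishes. -/
theorem errorA_isIndexOne (h : ∀ i, IsIndexOne E (A - H i * localOutput C i)) :
    IsIndexOne (errorE N E) (errorA E A C G H W γ) := by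
  intro v w hv hw
  have hE : ∀ i, (E *ᵥ fun a => v (i, a)) = 0 := by
    intro i
    rw [← errorE_mulVec, hv]
    rfl
  funext ⟨i, a⟩
  refine congrFun (h i (fun a => v (i, a)) (fun a => w (i, a)) (hE i) ?_) a
  have h1 := errorA_mulVec E A C G H W γ v i
  rw [hw, errorE_mulVec] at h1
  simpa [hE] using h1.symm

/-- The estimation errors satisfy the error dynamics. -/
theorem isTrajectory_error {x : ℝ → Fin n → ℝ} {xh : Fin N → ℝ → Fin n → ℝ}
    (hx : IsTrajectory E A x) (hxh : IsDistributedObserver E A C G H W γ x xh) :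
    IsTrajectory (errorE N E) (errorA E A C G H W γ) fun t b => xh b.1 t b.2 - x t b.2 := by
  intro t ht
  have hd : ∀ i, HasDerivAt (fun t => xh i t - x t) (deriv (xh i) t - deriv x t) t := fun i =>
    (hxh i t ht).1.hasDerivAt.sub (hx t ht).1.hasDerivAt
  have hD : HasDerivAt (fun t (b : Fin N × Fin n) => xh b.1 t b.2 - x t b.2)
      (fun b => deriv (xh b.1) t b.2 - deriv x t b.2) t :=
    hasDerivAt_pi.2 fun b => hasDerivAt_pi.1 (hd b.1) b.2
  refine ⟨hD.differentiableAt, ?_⟩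
  rw [hD.deriv]
  funext ⟨i, a⟩
  have h1 := errorE_mulVec E (fun b : Fin N × Fin n => deriv (xh b.1) t b.2 - deriv x t b.2) i
  have h2 := errorA_mulVec E A C G H W γ (fun b : Fin N × Fin n => xh b.1 t b.2 - x t b.2) i
  refine congrFun (h1.trans (Eq.trans ?_ h2.symm)) a
  change E *ᵥ (deriv (xh i) t - deriv x t) =
    (A - H i * localOutput C i) *ᵥ (xh i t - x t) -
      γ • ((W i)⁻¹ *ᵥ ∑ j, digraphLaplacian G i j • (E *ᵥ (xh j t - x t)))
  -- The true state cancels in the differences between neighbours.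
  have h3 : ∑ j, digraphLaplacian G i j • (E *ᵥ (xh j t - x t)) =
      -∑ j, adjWeight G i j • (E *ᵥ xh j t - E *ᵥ xh i t) := by
    have h4 : ∀ j, adjWeight G i j • (E *ᵥ xh j t - E *ᵥ xh i t) =
        adjWeight G i j • (E *ᵥ (xh j t - x t)) - adjWeight G i j • (E *ᵥ (xh i t - x t)) := by
      intro j
      rw [← smul_sub, mulVec_sub, mulVec_sub, sub_sub_sub_cancel_right]
    simp only [digraphLaplacian, Matrix.sub_apply, sub_smul, Finset.sum_sub_distrib, h4,
      Matrix.diagonal_apply, ite_smul, zero_smul, Finset.sum_ite_eq, Finset.mem_univ, if_true,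
      Finset.sum_smul]
    abel
  rw [h3, mulVec_sub, (hxh i t ht).2, (hx t ht).2, mulVec_neg, smul_neg, sub_neg_eq_add,
    sub_mulVec, ← mulVec_mulVec]
  simp only [mulVec_sub]
  abel

end ErrorDynamics

/-! ### Lyapunov estimate for the whole network -/

section Convergence

variable {N n : ℕ} {p : Fin N → ℕ} {E A : Matrix (Fin n) (Fin n) ℝ}
  {C : Matrix (Σ i, Fin (p i)) (Fin n) ℝ} (S : StdForm E A)
  {G : Digraph (Fin N)} [DecidableRel G.Adj]
  (D₁ : ∀ i, ObsDecomp (S.C₁ (localOutput C i)) S.A₁)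
  (D₂ : ∀ i, ObsDecomp (S.C₂ (localOutput C i)) S.N₂)

/-- The local outputs stack up to the full output, so a state unseen by every agent is unseen by
`C`. -/
theorem eq_zero_of_localOutput (hR : IsRObservable S C) (v : Fin S.n₁ → ℝ)
    (hv : ∀ i, ∀ k : ℕ, S.C₁ (localOutput C i) *ᵥ (S.A₁ ^ k *ᵥ v) = 0) : v = 0 := by
  refine IsObservablePair.eq_zero hR fun k => ?_
  funext ⟨i, a⟩
  exact congrFun (hv i k) a

variable {D₁ D₂} {r : Fin N → ℝ}
  {Y Wo : ∀ i, Matrix (Fin (D₁ i).v ⊕ Fin (D₂ i).v) (Fin (D₁ i).v ⊕ Fin (D₂ i).v) ℝ}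

/-- The joint bound as an inequality between quadratic forms. -/
theorem IsJointBound.le {μ : ℝ} (h : IsJointBound D₁ D₂ G r Y μ)
    (y : ∀ i, (Fin (D₁ i).v ⊕ Fin (D₁ i).u) ⊕ (Fin (D₂ i).v ⊕ Fin (D₂ i).u) → ℝ) :
    μ * ∑ i, y i ⬝ᵥ y i ≤
      ∑ i, ∑ j, symLaplacian G r i j *
        ((localT (D₁ i) (D₂ i) *ᵥ y i) ⬝ᵥ (localT (D₁ j) (D₂ j) *ᵥ y j)) +
      ∑ i, r i * (obsPart (y i) ⬝ᵥ Y i *ᵥ obsPart (y i)) := by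
  have h1 : (jointMatrix D₁ D₂ G r Y - μ • 1).PosDef := h
  have h2 := h1.posSemidef.dotProduct_mulVec_nonneg (fun b => y b.1 b.2)
  rw [star_trivial, sub_mulVec, dotProduct_sub, smul_mulVec, one_mulVec, dotProduct_smul,
    jointMatrix_quadForm, dotProduct_sigma, smul_eq_mul, sub_nonneg] at h2
  exact h2

theorem sum_localYu_le
    (s : ∀ i, Fin (D₁ i).v ⊕ Fin (D₁ i).u → ℝ) :
    ∑ i, r i * (s i ⬝ᵥ localYu (D₁ i) *ᵥ s i) ≤
      maxSingularValue (globalYu D₁ r) * ∑ i, s i ⬝ᵥ s i := by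
  have h1 := dotProduct_mulVec_le_maxSingularValue (globalYu D₁ r) fun b => s b.1 b.2
  rw [dotProduct_sigma, dotProduct_sigma] at h1
  refine le_of_eq_of_le (Finset.sum_congr rfl fun i _ => ?_) h1
  have hb := blockDiagonal'_mulVec (κ := fun i => Fin (D₁ i).v ⊕ Fin (D₁ i).u)
    (fun i => r i • localYu (D₁ i)) (fun b => s b.1 b.2) i
  rw [globalYu, hb, smul_mulVec, dotProduct_smul, smul_eq_mul]

/-- The contribution of one agent to the derivative of the Lyapunov function. -/
theorem agent_lyapunov (i : Fin N) (hu : (D₂ i).u = 0) {γ : ℝ}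
    {H₁ : Matrix (Fin (D₁ i).v) (Fin (p i)) ℝ} {H₂ : Matrix (Fin (D₂ i).v) (Fin (p i)) ℝ}
    (hWo : (Wo i).PosDef) (hL :
      symPart ((localEo (D₁ i) (D₂ i))ᵀ * Wo i * localAcl (D₁ i) (D₂ i) H₁ H₂) =
        -(γ • ((localEo (D₁ i) (D₂ i))ᵀ * Y i * localEo (D₁ i) (D₂ i))))
    (v : Fin N → Fin n → ℝ)
    {y : ∀ i, (Fin (D₁ i).v ⊕ Fin (D₁ i).u) ⊕ (Fin (D₂ i).v ⊕ Fin (D₂ i).u) → ℝ}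
    (hy : ∀ i, y i = fullEo (D₁ i) (D₂ i) *ᵥ coords S (D₁ i) (D₂ i) (v i)) :
    (E *ᵥ v i) ⬝ᵥ (r i • lyapM S (D₁ i) (D₂ i) (Wo i)) *ᵥ
      ((A - gainH S (D₁ i) (D₂ i) H₁ H₂ * localOutput C i) *ᵥ v i -
        γ • ((weightW S (D₁ i) (D₂ i) (Wo i))⁻¹ *ᵥ
          ∑ j, digraphLaplacian G i j • (E *ᵥ v j))) =
      2⁻¹ * (-γ * (r i * (obsPart (y i) ⬝ᵥ Y i *ᵥ obsPart (y i))) +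
        r i * ((y i ∘ Sum.inl) ⬝ᵥ localYu (D₁ i) *ᵥ (y i ∘ Sum.inl))) -
      γ * (r i * ∑ j, digraphLaplacian G i j *
        ((localT (D₁ i) (D₂ i) *ᵥ y i) ⬝ᵥ (localT (D₁ j) (D₂ j) *ᵥ y j))) := by
  have hQE : ∀ i, S.Q *ᵥ (E *ᵥ v i) = localT (D₁ i) (D₂ i) *ᵥ y i := fun i => by
    rw [hy, Q_mulVec_E S (D₁ i) (D₂ i)]
  have h1 := local_lyapunov (D₁ i) (D₂ i) H₁ H₂ (coords S (D₁ i) (D₂ i) (v i)) hu hL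
  rw [← hy] at h1
  have h2 : (E *ᵥ v i) ⬝ᵥ lyapM S (D₁ i) (D₂ i) (Wo i) *ᵥ
      ((A - gainH S (D₁ i) (D₂ i) H₁ H₂ * localOutput C i) *ᵥ v i) =
      y i ⬝ᵥ extendObs (Wo i) 1 *ᵥ
        (fullAcl (D₁ i) (D₂ i) H₁ H₂ *ᵥ coords S (D₁ i) (D₂ i) (v i)) := by
    rw [dotProduct_lyapM, hQE, Q_mulVec_closedLoop,
      localT_transpose_mulVec_localT_mulVec S (D₁ i) (D₂ i),
      localT_transpose_mulVec_localT_mulVec S (D₁ i) (D₂ i)]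
  have h3 : (E *ᵥ v i) ⬝ᵥ lyapM S (D₁ i) (D₂ i) (Wo i) *ᵥ
      ((weightW S (D₁ i) (D₂ i) (Wo i))⁻¹ *ᵥ ∑ j, digraphLaplacian G i j • (E *ᵥ v j)) =
      ∑ j, digraphLaplacian G i j *
        ((localT (D₁ i) (D₂ i) *ᵥ y i) ⬝ᵥ (localT (D₁ j) (D₂ j) *ᵥ y j)) := by
    rw [dotProduct_lyapM_inv S (D₁ i) (D₂ i) hWo, hQE, mulVec_sum, dotProduct_sum]
    refine Finset.sum_congr rfl fun j _ => ?_
    rw [mulVec_smul, dotProduct_smul, smul_eq_mul, hQE]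
  rw [smul_mulVec, dotProduct_smul, smul_eq_mul, mulVec_sub, dotProduct_sub, h2, mulVec_smul,
    dotProduct_smul, smul_eq_mul, h3]
  linear_combination (r i / 2) * h1

/-- Impulse-freeness of the local loops gives index one; decay comes from the Lyapunov equations,
the joint bound and the size of `γ`. -/
theorem error_isAdmissible (hu : ∀ i, (D₂ i).u = 0) (hr : ∀ i, 0 < r i) {μ γ : ℝ} (hμ : 0 < μ)
    (hJ : IsJointBound D₁ D₂ G r Y μ) (hγ : maxSingularValue (globalYu D₁ r) / μ < γ)
    {H₁ : ∀ i, Matrix (Fin (D₁ i).v) (Fin (p i)) ℝ}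
    {H₂ : ∀ i, Matrix (Fin (D₂ i).v) (Fin (p i)) ℝ}
    (hadm : ∀ i, IsAdmissible (localEo (D₁ i) (D₂ i)) (localAcl (D₁ i) (D₂ i) (H₁ i) (H₂ i)))
    (hWo : ∀ i, (Wo i).PosDef ∧
      symPart ((localEo (D₁ i) (D₂ i))ᵀ * Wo i * localAcl (D₁ i) (D₂ i) (H₁ i) (H₂ i)) =
        -(γ • ((localEo (D₁ i) (D₂ i))ᵀ * Y i * localEo (D₁ i) (D₂ i)))) :
    IsAdmissible (errorE N E) (errorA E A C G (fun i => gainH S (D₁ i) (D₂ i) (H₁ i) (H₂ i))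
      (fun i => weightW S (D₁ i) (D₂ i) (Wo i)) γ) := by
  have hind := errorA_isIndexOne E A C G (fun i => gainH S (D₁ i) (D₂ i) (H₁ i) (H₂ i))
    (fun i => weightW S (D₁ i) (D₂ i) (Wo i)) γ fun i => by
      obtain ⟨-, ⟨S', hS'⟩, -⟩ := hadm i
      exact closedLoop_isIndexOne S (D₁ i) (D₂ i) (H₁ i) (H₂ i) (hu i) (S'.isIndexOne hS')
  -- `c` compares `|E e_i|²` with `|Q E e_i|² = |y i|²`. Half the derivative of `V` is at most `-(γ
  -- μ - σ̄) / 2` times `∑ |y i|²`, whence the `δ` below.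
  obtain ⟨c, hc, hcQ⟩ := exists_bound_quadForm (1 : Matrix (Fin n) (Fin n) ℝ) (S.Qᵀ * S.Q)
    S.posDef_transpose_mul_self
  rw [div_lt_iff₀ hμ] at hγ
  have hγ0 : 0 < γ := by
    have := (maxSingularValue_nonneg (globalYu D₁ r)).trans_lt hγ
    exact pos_of_mul_pos_left this hμ.le
  have hκ : 0 < γ * μ - maxSingularValue (globalYu D₁ r) := sub_pos.2 hγ
  refine hind.isAdmissible
    (M := prodDiagonal fun i => r i • lyapM S (D₁ i) (D₂ i) (Wo i))
    (δ := (γ * μ - maxSingularValue (globalYu D₁ r)) / (2 * c))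
    (prodDiagonal_posDef fun i => (lyapM_posDef S (D₁ i) (D₂ i) (hWo i).1).smul (hr i))
    (by positivity) fun v => ?_
  rw [dotProduct_prod, dotProduct_prod]
  simp only [prodDiagonal_mulVec, errorE_mulVec, errorA_mulVec]
  let y := fun i => fullEo (D₁ i) (D₂ i) *ᵥ coords S (D₁ i) (D₂ i) fun a => v (i, a)
  have hQE : ∀ i, S.Q *ᵥ (E *ᵥ fun a => v (i, a)) = localT (D₁ i) (D₂ i) *ᵥ y i := fun i =>
    Q_mulVec_E S (D₁ i) (D₂ i) _
  have hagent := fun i => agent_lyapunov S (G := G) (r := r) i (hu i) (hWo i).1 (hWo i).2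
    (fun i a => v (i, a)) (y := y) fun _ => rfl
  clear_value y
  have hnorm : ∑ i, (E *ᵥ fun a => v (i, a)) ⬝ᵥ (E *ᵥ fun a => v (i, a)) ≤
      c * ∑ i, y i ⬝ᵥ y i := by
    rw [Finset.mul_sum]
    refine Finset.sum_le_sum fun i _ => ?_
    have h1 := hcQ (E *ᵥ fun a => v (i, a))
    rwa [one_mulVec, ← mulVec_mulVec, ← mulVec_dotProduct_eq, hQE, dotProduct_localT_mulVec] at h1
  -- `Ỹᵤ` sees only slow coordinates, whereas the joint bound controls all of them.
  have hslow : ∑ i, (y i ∘ Sum.inl) ⬝ᵥ (y i ∘ Sum.inl) ≤ ∑ i, y i ⬝ᵥ y i := by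
    refine Finset.sum_le_sum fun i _ => ?_
    rw [dotProduct_block (y i) (y i)]
    exact le_add_of_nonneg_right (dotProduct_self_nonneg' _)
  have hJy := IsJointBound.le S hJ y
  have hYu := (sum_localYu_le S (r := r) fun i => y i ∘ Sum.inl).trans
    (mul_le_mul_of_nonneg_left hslow (maxSingularValue_nonneg (globalYu D₁ r)))
  rw [sum_symLaplacian] at hJy
  simp only [hagent, Finset.sum_sub_distrib, ← Finset.mul_sum, Finset.sum_add_distrib]
  have h5 : (γ * μ - maxSingularValue (globalYu D₁ r)) / (2 * c) *
      ∑ i, (E *ᵥ fun a => v (i, a)) ⬝ᵥ (E *ᵥ fun a => v (i, a)) ≤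
      2⁻¹ * ((γ * μ - maxSingularValue (globalYu D₁ r)) * ∑ i, y i ⬝ᵥ y i) := by
    refine (mul_le_mul_of_nonneg_left hnorm (by positivity)).trans_eq ?_
    field_simp
  have h6 := mul_le_mul_of_nonneg_left hJy hγ0.le
  linarith

end Convergence

theorem theorem1 {N n : ℕ} {p : Fin N → ℕ}
    -- the regular descriptor system `E x' = A x`, `y = C x`
    (E A : Matrix (Fin n) (Fin n) ℝ) (C : Matrix (Σ i, Fin (p i)) (Fin n) ℝ)
    (hreg : IsRegularPencil E A)
    -- its standard decomposition form, R- and I-observability from the full output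
    (S : StdForm E A) (hR : IsRObservable S C) (hI : IsIObservable S C)
    -- the strongly connected communication graph
    (G : Digraph (Fin N)) [DecidableRel G.Adj] (hG : IsStronglyConnected G)
    -- observability decompositions of the local slow and fast pairs, the local fast
    -- pairs having observability index `n₂`
    (D₁ : ∀ i, ObsDecomp (S.C₁ (localOutput C i)) S.A₁)
    (D₂ : ∀ i, ObsDecomp (S.C₂ (localOutput C i)) S.N₂)
    (hv : ∀ i, obsIndex (S.C₂ (localOutput C i)) S.N₂ = S.n₂)
    -- the arbitrary positive definite right-hand sides of the Lyapunov equations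
    (Y : ∀ i, Matrix (Fin (D₁ i).v ⊕ Fin (D₂ i).v) (Fin (D₁ i).v ⊕ Fin (D₂ i).v) ℝ)
    (hY : ∀ i, (Y i).PosDef) :
    (∃ r : Fin N → ℝ, IsLeftWeight G r) ∧
    ∀ r : Fin N → ℝ, IsLeftWeight G r →
      (∃ μ : ℝ, 0 < μ ∧ IsJointBound D₁ D₂ G r Y μ) ∧
      ∀ μ : ℝ, 0 < μ → IsJointBound D₁ D₂ G r Y μ →
      ∀ γ : ℝ, maxSingularValue (globalYu D₁ r) / μ < γ →
      ∀ (H₁ : ∀ i, Matrix (Fin (D₁ i).v) (Fin (p i)) ℝ)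
        (H₂ : ∀ i, Matrix (Fin (D₂ i).v) (Fin (p i)) ℝ),
      (∀ i, IsAdmissible (localEo (D₁ i) (D₂ i)) (localAcl (D₁ i) (D₂ i) (H₁ i) (H₂ i))) →
      ∀ Wo : ∀ i, Matrix (Fin (D₁ i).v ⊕ Fin (D₂ i).v) (Fin (D₁ i).v ⊕ Fin (D₂ i).v) ℝ,
      (∀ i, (Wo i).PosDef ∧
        symPart ((localEo (D₁ i) (D₂ i))ᵀ * Wo i * localAcl (D₁ i) (D₂ i) (H₁ i) (H₂ i)) =
          -(γ • ((localEo (D₁ i) (D₂ i))ᵀ * Y i * localEo (D₁ i) (D₂ i)))) →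
      ∀ (H : ∀ i, Matrix (Fin n) (Fin (p i)) ℝ) (W : Fin N → Matrix (Fin n) (Fin n) ℝ),
      (∀ i, H i = gainH S (D₁ i) (D₂ i) (H₁ i) (H₂ i)) →
      (∀ i, W i = weightW S (D₁ i) (D₂ i) (Wo i)) →
      -- the weights are invertible, the error dynamics are admissible, and every local estimate
      -- converges to the state
      (∀ i, IsUnit (W i).det) ∧
      IsAdmissible (errorE N E) (errorA E A C G H W γ) ∧
      ∀ (x : ℝ → Fin n → ℝ) (xh : Fin N → ℝ → Fin n → ℝ),
        IsTrajectory E A x → IsDistributedObserver E A C G H W γ x xh →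
        ∀ i, Tendsto (fun t => xh i t - x t) atTop (𝓝 0) := by
  -- The two block sizes add up to `n₂`, and the observable one is already `n₂`.
  have hu : ∀ i, (D₂ i).u = 0 := fun i => by
    have h1 := (D₂ i).add_eq
    have h2 := (D₂ i).v_eq
    have h3 := hv i
    omega
  refine ⟨exists_isLeftWeight hG, fun r hr => ⟨?_, ?_⟩⟩
  · exact (jointMatrix_posDef D₁ D₂ G Y hG hr hY (eq_zero_of_localOutput S hR)
      hu).exists_sub_smul_one
  · intro μ hμ hJ γ hγ H₁ H₂ hadm Wo hWo H W hH hW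
    obtain rfl : H = fun i => gainH S (D₁ i) (D₂ i) (H₁ i) (H₂ i) := funext hH
    obtain rfl : W = fun i => weightW S (D₁ i) (D₂ i) (Wo i) := funext hW
    have hE := error_isAdmissible S hu hr.1 hμ hJ hγ hadm hWo
    refine ⟨fun i => isUnit_det_weightW S (D₁ i) (D₂ i) (hWo i).1, hE, fun x xh hx hxh i => ?_⟩
    have h := hE.2.2 _ (isTrajectory_error E A C G _ _ γ hx hxh)
    rw [tendsto_pi_nhds] at h ⊢
    exact fun a => h (i, a)
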